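/- **Setting.** Let $d,m,T$ be positive integers with $mTd\ge 2$, let $\|\cdot\|$ be the $L_q$ norm on $\mathbb R^d$ ($1\le q\le\infty$) with dual norm $\|\cdot\|_*$, and let $\mathbf 1_d$ be the all-ones vector. There are $m$ arms; arm $i$ has an unknown law $\nu_i$ on $[0,1]^d$ with mean $\mu_i$, the $i$-th column of the matrix $\mu\in[0,1]^{d\times m}$. In each round $t=1,\dots,T$ an arm $i_t$ is played on the basis of the past (possibly with randomization), and a vector $v_t$ is observed which, given $i_t$ and the past, has law $\nu_{i_t}$. In the problem BwR (bandits with concave rewards) a concave $f:[0,1]^d\to[0,1]$ with $f(x)-f(y)\le L\|x-y\|$ is given; $\mathrm{OPT}_f$ is the supremum over all non-anticipating policies of $\mathbb E f(\frac1T\sum_t v_t)$, and the average regret is $\mathrm{areg}_1(T)=\mathrm{OPT}_f-f(\frac1T\sum_t v_t)$. In the problem BwC (bandits with convex knapsacks) a convex $S\subseteq\mathbb R^d$ is given such that $\mu p^*\in S$ for some $p^*$ in the simplex $\Delta_m$, and the average regret is $\mathrm{areg}_2(T)=d(\frac1T\sum_t v_t,S)$, where $d(\cdot,S)$ is the distance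 in $\|\cdot\|$. **Algorithm.** For a parameter $\gamma>0$ let $\mathrm{rad}(x,N)=\sqrt{\gamma x/N}+\gamma/N$. Let $k_{t,i}$ be the number of plays of arm $i$ before round $t$, $\hat\mu_{t,ji}=\frac{1}{k_{t,i}+1}\sum_{s<t,\,i_s=i}v_{s,j}$, $\mathrm{UCB}_{t,ji}=\min\{1,\hat\mu_{t,ji}+2\,\mathrm{rad}(\hat\mu_{t,ji},k_{t,i}+1)\}$, $\mathrm{LCB}_{t,ji}=\max\{0,\hat\mu_{t,ji}-2\,\mathrm{rad}(\hat\mu_{t,ji},k_{t,i}+1)\}$, and let $H_t$ be the hypercube of all matrices $A$ with $\mathrm{LCB}_{t,ji}\le A_{ji}\le\mathrm{UCB}_{t,ji}$ for all $j,i$. Let $f^*(\theta)=\max_{y\in[0,1]^d}\{y\cdot\theta+f(y)\}$. Fix any online convex optimization (OCO) method on the domain $\{\|\theta\|_*\le L\}$. In round $t$ the Fenchel-dual algorithm for $f$ takes $\theta_t$ from the OCO method, given the earlier losses $g_1,\dots,g_{t-1}$; it chooses $(p_t,\tilde\mu_t)$ minimizing $\theta_t\cdot(Ap)$ over $p\in\Delta_m$,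 $A\in H_t$; it plays an arm drawn from $p_t$; and it sets $g_t(\theta)=f^*(\theta)-\theta\cdot x_t$ with $x_t=\tilde\mu_tp_t$. Let $\mathrm{Reg}_{OCO}(T)=\sum_{t\le T}g_t(\theta_t)-\min_{\|\theta\|_*\le L}\sum_{t\le T}g_t(\theta)$. **Theorem 3.** There are absolute constants $c_0,C>0$ such that for all $\delta\in(0,1)$ and $\gamma\ge c_0\ln(mTd/\delta)$ (in particular for some $\gamma=O(\ln(mTd/\delta))$) the following holds. For BwR, with probability at least $1-\delta$ the Fenchel-dual algorithm for $f$ satisfies $$\mathrm{areg}_1(T)\le C\,L\,\|\mathbf 1_d\|\sqrt{\frac{\gamma m}{T}}+\frac{\mathrm{Reg}_{OCO}(T)}{T}.$$ For BwC, with probability at least $1-\delta$ the Fenchel-dual algorithm for the function $x\mapsto-d(x,S)$ and with $L=1$ satisfies $$\mathrm{areg}_2(T)\le C\,\|\mathbf 1_d\|\sqrt{\frac{\gamma m}{T}}+\frac{\mathrm{Reg}_{OCO}(T)}{T}.$$ -/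

import Mathlib

open MeasureTheory ProbabilityTheory Matrix

noncomputable section

namespace BwCR

/-! ### Norms, distances and the Fenchel conjugate on `ℝ^d` -/

/-- The cube `[0,1]^d`. -/
def unitCube (d : ℕ) : Set (Fin d → ℝ) := Set.Icc 0 1

/-- The `L_q` norm on `ℝ^d`, `1 ≤ q ≤ ∞`. -/
def lqNorm (q : ENNReal) [Fact (1 ≤ q)] {d : ℕ} (x : Fin d → ℝ) : ℝ := ‖WithLp.toLp q x‖

/-- The dual norm of the `L_q` norm: `‖θ‖_* = sup {θ · x : ‖x‖ ≤ 1}`. -/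
def dualNorm (q : ENNReal) [Fact (1 ≤ q)] {d : ℕ} (θ : Fin d → ℝ) : ℝ :=
  sSup {r : ℝ | ∃ x : Fin d → ℝ, lqNorm q x ≤ 1 ∧ r = θ ⬝ᵥ x}

/-- The ball `{θ : ‖θ‖_* ≤ L}`, the domain of the online convex optimization problem. -/
def dualBall (q : ENNReal) [Fact (1 ≤ q)] (d : ℕ) (L : ℝ) : Set (Fin d → ℝ) :=
  {θ | dualNorm q θ ≤ L}

/-- The distance `d(x, S)` from a point to a set in the `L_q` norm. -/
def lqDist (q : ENNReal) [Fact (1 ≤ q)] {d : ℕ} (x : Fin d → ℝ) (S : Set (Fin d → ℝ)) : ℝ :=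
  Metric.infDist (WithLp.toLp q x) (WithLp.toLp q '' S)

/-- The Fenchel conjugate `f^*(θ) = max_{y ∈ [0,1]^d} (y · θ + f y)`. -/
def fenchel {d : ℕ} (f : (Fin d → ℝ) → ℝ) (θ : Fin d → ℝ) : ℝ :=
  sSup ((fun y => y ⬝ᵥ θ + f y) '' unitCube d)

/-! ### The bandit model

Rounds are numbered `0, …, T - 1`.  The σ-algebra `ℱ t` is what is known before round `t`.
The arms are `Fin m`; `ν i` is the law on `ℝ^d` of the observation when arm `i` is played. -/

/-- The `d × m` matrix whose `i`-th column is the mean observation of arm `i`. -/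
def meanMatrix {d m : ℕ} (ν : Fin m → Measure (Fin d → ℝ)) : Matrix (Fin d) (Fin m) ℝ :=
  Matrix.of fun j i => ∫ v, v j ∂(ν i)

/-- `I` (arms played) and `V` (observed vectors) come from a non-anticipating, possibly randomized
and adaptive, play of `T` rounds: given that arm `i` is played in round `t`, the observation has
law `ν i` and is independent of everything that happened before. -/
structure IsInteraction {d m : ℕ} (T : ℕ) (ν : Fin m → Measure (Fin d → ℝ))
    {Ω : Type*} [mΩ : MeasurableSpace Ω] (P : Measure Ω) (ℱ : Filtration ℕ mΩ)
    (I : ℕ → Ω → Fin m) (V : ℕ → Ω → Fin d → ℝ) : Prop where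
  arm_measurable : ∀ t < T, Measurable[ℱ (t + 1)] (I t)
  obs_measurable : ∀ t < T, Measurable[ℱ (t + 1)] (V t)
  obs_mem : ∀ t < T, ∀ ω, V t ω ∈ unitCube d
  obs_law : ∀ t < T, ∀ A : Set Ω, MeasurableSet[ℱ t] A → ∀ (i : Fin m) (B : Set (Fin d → ℝ)),
    MeasurableSet B →
      P (A ∩ {ω | I t ω = i} ∩ {ω | V t ω ∈ B}) = P (A ∩ {ω | I t ω = i}) * ν i B

/-- The average `(1/T) ∑_t v_t` of the observed vectors. -/
def avgObs {d : ℕ} (T : ℕ) (v : ℕ → Fin d → ℝ) : Fin d → ℝ :=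
  (T : ℝ)⁻¹ • ∑ t ∈ Finset.range T, v t

/-- `OPT_f`: the best expected value of `f((1/T) ∑_t v_t)` over all (adaptive, randomized,
non-anticipating) policies, which may know the distributions `ν`. -/
def optValue {d m : ℕ} (T : ℕ) (ν : Fin m → Measure (Fin d → ℝ)) (f : (Fin d → ℝ) → ℝ) : ℝ :=
  sSup {r : ℝ | ∃ (Ω : Type) (mΩ : MeasurableSpace Ω) (P : Measure Ω) (ℱ : Filtration ℕ mΩ)
    (I : ℕ → Ω → Fin m) (V : ℕ → Ω → Fin d → ℝ),
    IsProbabilityMeasure P ∧ IsInteraction T ν P ℱ I V ∧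
      r = ∫ ω, f (avgObs T fun t => V t ω) ∂P}

/-! ### Confidence bounds

Here `I` and `V` are one realization of the sequences of arms and observations. -/

/-- `k_{t,i}`: how often arm `i` was played before round `t`. -/
def plays {m : ℕ} (I : ℕ → Fin m) (t : ℕ) (i : Fin m) : ℕ :=
  {s ∈ Finset.range t | I s = i}.card

/-- The empirical average of component `j` for arm `i` (with `k_{t,i} + 1` in the denominator). -/
def empMean {d m : ℕ} (I : ℕ → Fin m) (V : ℕ → Fin d → ℝ) (t : ℕ) (j : Fin d) (i : Fin m) : ℝ :=
  (∑ s ∈ Finset.range t with I s = i, V s j) / ((plays I t i : ℝ) + 1)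

/-- The confidence radius `√(γ x / N) + γ / N`. -/
def rad (γ x N : ℝ) : ℝ := Real.sqrt (γ * x / N) + γ / N

/-- Upper confidence bound. -/
def ucb {d m : ℕ} (γ : ℝ) (I : ℕ → Fin m) (V : ℕ → Fin d → ℝ) (t : ℕ) (j : Fin d) (i : Fin m) :
    ℝ :=
  min 1 (empMean I V t j i + 2 * rad γ (empMean I V t j i) ((plays I t i : ℝ) + 1))

/-- Lower confidence bound. -/
def lcb {d m : ℕ} (γ : ℝ) (I : ℕ → Fin m) (V : ℕ → Fin d → ℝ) (t : ℕ) (j : Fin d) (i : Fin m) :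
    ℝ :=
  max 0 (empMean I V t j i - 2 * rad γ (empMean I V t j i) ((plays I t i : ℝ) + 1))

/-- The hypercube `H_t` of all matrices between the lower and the upper confidence bounds. -/
def confBox {d m : ℕ} (γ : ℝ) (I : ℕ → Fin m) (V : ℕ → Fin d → ℝ) (t : ℕ) :
    Set (Matrix (Fin d) (Fin m) ℝ) :=
  {A | ∀ j i, lcb γ I V t j i ≤ A j i ∧ A j i ≤ ucb γ I V t j i}

/-! ### Online convex optimization and the Fenchel dual algorithm -/

/-- An online convex optimization method on the domain `K`: it maps the list of the loss functions
revealed so far (and a source `Ξ` of internal randomness) to its next point in `K`. -/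
structure OCOMethod {d : ℕ} (K : Set (Fin d → ℝ)) (Ξ : Type*) where
  predict : Ξ → List ((Fin d → ℝ) → ℝ) → (Fin d → ℝ)
  predict_mem : ∀ ξ l, predict ξ l ∈ K

/-- The regret `∑_t g_t(θ_t) - min_{u ∈ K} ∑_t g_t(u)` of a sequence of points. -/
def ocoRegret {d : ℕ} (K : Set (Fin d → ℝ)) (T : ℕ) (g : ℕ → (Fin d → ℝ) → ℝ)
    (θ : ℕ → Fin d → ℝ) : ℝ :=
  ∑ t ∈ Finset.range T, g t (θ t) -
    sInf ((fun u => ∑ t ∈ Finset.range T, g t u) '' K)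

/-- The loss `g(θ) = f^*(θ) - θ · x`. -/
def dualLoss {d : ℕ} (f : (Fin d → ℝ) → ℝ) (x θ : Fin d → ℝ) : ℝ := fenchel f θ - θ ⬝ᵥ x

/-- `(θ, p, est, I, V)` is a run of `T` rounds of the Fenchel dual algorithm for `f`, with
confidence parameter `γ` and the online convex optimization method `oco` (with randomness `ξ`):
in round `t` it has `θ_t` from the method fed with the earlier losses, chooses `(p_t, est_t)`
minimizing `θ_t · (A p)` over the simplex and the hypercube `H_t`, plays an arm drawn from `p_t`,
and observes a vector drawn from the law of that arm. -/
structure IsDualRun {d m : ℕ} (T : ℕ) (ν : Fin m → Measure (Fin d → ℝ)) (γ : ℝ)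
    (f : (Fin d → ℝ) → ℝ) {K : Set (Fin d → ℝ)} {Ξ : Type*} (oco : OCOMethod K Ξ)
    {Ω : Type*} [mΩ : MeasurableSpace Ω] (P : Measure Ω) (ℱ : Filtration ℕ mΩ) (ξ : Ω → Ξ)
    (θ : ℕ → Ω → Fin d → ℝ) (p : ℕ → Ω → Fin m → ℝ) (est : ℕ → Ω → Matrix (Fin d) (Fin m) ℝ)
    (I : ℕ → Ω → Fin m) (V : ℕ → Ω → Fin d → ℝ) : Prop where
  interaction : IsInteraction T ν P ℱ I V
  theta_measurable : ∀ t < T, Measurable[ℱ t] (θ t)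
  prob_measurable : ∀ t < T, Measurable[ℱ t] (p t)
  est_measurable : ∀ t < T, ∀ j i, Measurable[ℱ t] (fun ω => est t ω j i)
  theta_eq : ∀ t < T, ∀ ω,
    θ t ω = oco.predict (ξ ω) ((List.range t).map fun s => dualLoss f (est s ω *ᵥ p s ω))
  prob_mem : ∀ t < T, ∀ ω, p t ω ∈ stdSimplex ℝ (Fin m)
  est_mem : ∀ t < T, ∀ ω, est t ω ∈ confBox γ (fun s => I s ω) (fun s => V s ω) t
  minimal : ∀ t < T, ∀ ω, ∀ p' ∈ stdSimplex ℝ (Fin m),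
    ∀ A ∈ confBox γ (fun s => I s ω) (fun s => V s ω) t,
      θ t ω ⬝ᵥ (est t ω *ᵥ p t ω) ≤ θ t ω ⬝ᵥ (A *ᵥ p')
  arm_law : ∀ t < T, ∀ A : Set Ω, MeasurableSet[ℱ t] A → ∀ i : Fin m,
    P (A ∩ {ω | I t ω = i}) = ∫⁻ ω in A, ENNReal.ofReal (p t ω i) ∂P

end BwCR

end

noncomputable section

namespace BwCR

open scoped ENNReal

/-! Let x̄ be the average of x_t = `est t ω *ᵥ p t ω`, v̄ the average observation, and y = μp' for a
fixed mixture p' of the arms. If μ lies in every box H_t, then (p', μ) competes in each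
minimization, so θ_t·x_t ≤ θ_t·y and g_t(θ_t) ≥ f*(θ_t) - θ_t·y ≥ f(y). On the other side, ∑ g_t(u)
= T(f*(u) - u·x̄), and Lipschitz concavity supplies u in the dual ball (`exists_supergradient`) at
which this is at most T f(x̄). Subtracting gives f(y) - f(x̄) ≤ Reg/T (`sub_le_ocoRegret_div`), and
passing from x̄ to v̄ costs L‖x̄ - v̄‖.

Each coordinate of x̄ - v̄ splits into three errors: drawing the arm from p_t instead of averaging
over it, the gap between estimate and mean at the played arm, and the observation noise. The first
and third are controlled by exponential supermartingales (`measure_le_sum_le_exp_neg`). The second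
is at most a confidence width of order √(γ/(k+1)), and these widths sum to O(√(γmT))
(`abs_avgObs_sub_le`). The same noise bound puts μ in all the boxes; a union bound collects
everything in `IsDualRun.exists_good_event`.

For rewards, Jensen bounds OPT_f by the values f(μp) (`optValue_le`), so the comparison with every
p' suffices. For knapsacks, f = -d(·,S) is concave and 1-Lipschitz with f(μp*) = 0. -/

/-! ### Convex duality and the regret inequality. -/

lemma lqNorm_le_of_abs_le (q : ENNReal) [Fact (1 ≤ q)] {d : ℕ} {x : Fin d → ℝ} {c : ℝ}
    (hc : 0 ≤ c) (h : ∀ j, |x j| ≤ c) : lqNorm q x ≤ c * lqNorm q (1 : Fin d → ℝ) := by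
  have hmono : ∀ y : Fin d → ℝ, (∀ j, |x j| ≤ y j) → lqNorm q x ≤ lqNorm q y := by
    intro y hy
    unfold lqNorm
    have hy0 : ∀ j, |x j| ≤ |y j| := fun j => (hy j).trans (le_abs_self _)
    rcases eq_or_ne q ⊤ with rfl | hq
    · rw [PiLp.norm_toLp, PiLp.norm_toLp]
      exact (pi_norm_le_iff_of_nonneg (norm_nonneg _)).2
        fun j => (hy0 j).trans (norm_le_pi_norm y j)
    · have hq1 : (1 : ENNReal) ≤ q := Fact.out
      have hpos : 0 < q.toReal := ENNReal.toReal_pos (zero_lt_one.trans_le hq1).ne' hq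
      rw [PiLp.norm_eq_sum hpos, PiLp.norm_eq_sum hpos]
      refine Real.rpow_le_rpow (by positivity) (Finset.sum_le_sum fun j _ => ?_) (by positivity)
      exact Real.rpow_le_rpow (norm_nonneg _) (hy0 j) hpos.le
  have h1 := hmono (c • 1) (by simpa using h)
  refine h1.trans_eq ?_
  unfold lqNorm
  rw [WithLp.toLp_smul, norm_smul, Real.norm_of_nonneg hc]

/-- Hahn–Banach separates the open cone r > L‖z - x‖ from the hypograph of f - f(x) over the cube;
the Lipschitz bound makes them disjoint. Using the cone, rather than a bare vertical ray, bounds the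
slope by L even when x is on the boundary of the cube. In the sign convention of f*, the
supergradient of f is -u. -/
lemma exists_supergradient (q : ENNReal) [Fact (1 ≤ q)] {d : ℕ} {f : (Fin d → ℝ) → ℝ} {L : ℝ}
    (hL : 0 ≤ L) (hf : ConcaveOn ℝ (unitCube d) f)
    (hlip : ∀ x ∈ unitCube d, ∀ y ∈ unitCube d, f x - f y ≤ L * lqNorm q (x - y))
    {x : Fin d → ℝ} (hx : x ∈ unitCube d) :
    ∃ u ∈ dualBall q d L, ∀ y ∈ unitCube d, y ⬝ᵥ u + f y ≤ x ⬝ᵥ u + f x := by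
  let E := PiLp q (fun _ : Fin d => ℝ)
  let x' : E := WithLp.toLp q x
  let U : Set (E × ℝ) := {z | L * ‖z.1 - x'‖ < z.2}
  let H : Set (E × ℝ) := {z | z.1.ofLp ∈ unitCube d ∧ z.2 ≤ f z.1.ofLp - f x}
  have hUo : IsOpen U := isOpen_lt (by fun_prop) (by fun_prop)
  have hUc : Convex ℝ U := by
    intro z hz w hw a b ha hb hab
    simp only [U, Set.mem_ofPred_eq, Prod.fst_add, Prod.snd_add, Prod.smul_fst, Prod.smul_snd,
      smul_eq_mul] at hz hw ⊢
    have e : a • z.1 + b • w.1 - x' = a • (z.1 - x') + b • (w.1 - x') := by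
      rw [smul_sub, smul_sub]
      have : x' = a • x' + b • x' := by rw [← add_smul, hab, one_smul]
      nth_rw 1 [this]
      abel
    have h1 : ‖a • (z.1 - x') + b • (w.1 - x')‖ ≤ a * ‖z.1 - x'‖ + b * ‖w.1 - x'‖ := by
      refine (norm_add_le _ _).trans_eq ?_
      rw [norm_smul, norm_smul, Real.norm_of_nonneg ha, Real.norm_of_nonneg hb]
    rw [e]
    have h2 := mul_le_mul_of_nonneg_left h1 hL
    rcases ha.eq_or_lt with rfl | ha'
    · have : b = 1 := by linarith
      subst this
      nlinarith
    · have := mul_lt_mul_of_pos_left hz ha'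
      have := mul_le_mul_of_nonneg_left hw.le hb
      nlinarith
  have hHc : Convex ℝ H := by
    intro z hz w hw a b ha hb hab
    refine ⟨?_, ?_⟩
    · exact hf.1 hz.1 hw.1 ha hb hab
    · have h1 := hf.2 hz.1 hw.1 ha hb hab
      have h2 := mul_le_mul_of_nonneg_left hz.2 ha
      have h3 := mul_le_mul_of_nonneg_left hw.2 hb
      rw [smul_eq_mul, smul_eq_mul] at h1
      change a * z.2 + b * w.2 ≤ f (a • z.1.ofLp + b • w.1.ofLp) - f x
      have : f x = a * f x + b * f x := by rw [← add_mul, hab, one_mul]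
      linarith
  have hdisj : Disjoint U H := by
    refine Set.disjoint_left.2 fun z hz hz' => ?_
    have h1 := hlip _ hz'.1 x hx
    have h2 := hz'.2
    have h3 : L * ‖z.1 - x'‖ < z.2 := hz
    have h4 : lqNorm q (z.1.ofLp - x) = ‖z.1 - x'‖ := rfl
    rw [h4] at h1
    linarith
  obtain ⟨φ, u, hU, hH⟩ := geometric_hahn_banach_open hUc hUo hHc hdisj
  have hdecomp : ∀ z : E × ℝ, φ z = φ (z.1, 0) + z.2 * φ (0, 1) := by
    intro z
    have : z = (z.1, (0 : ℝ)) + z.2 • ((0 : E), (1 : ℝ)) := by ext <;> simp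
    conv_lhs => rw [this]
    rw [map_add, map_smul, smul_eq_mul]
  set s := φ (0, 1) with hs
  have hxH : u ≤ φ (x', 0) := hH _ ⟨hx, by simp [x']⟩
  -- The hyperplane is not vertical: (x', 1) is in the cone while (x', 0) is in the hypograph.
  have hs0 : s < 0 := by
    have h1 := hU (x', 1) (by simp [U])
    rw [hdecomp] at h1
    simp only at h1
    linarith
  -- The closed cone, reached by letting the excess height ε/(-s) tend to 0.
  have hle : ∀ y : E, φ (y, 0) + L * ‖y - x'‖ * s ≤ u := by
    intro y
    refine le_of_forall_pos_le_add fun ε hε => ?_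
    have h1 := hU (y, L * ‖y - x'‖ + ε / (-s)) (by
      simp only [U, Set.mem_ofPred_eq]
      have : 0 < ε / (-s) := div_pos hε (by linarith)
      linarith)
    rw [hdecomp] at h1
    simp only at h1
    have h2 : ε / (-s) * s = -ε := by rw [div_neg, neg_mul, div_mul_cancel₀ _ hs0.ne]
    nlinarith
  have hux : u = φ (x', 0) := le_antisymm hxH (by simpa using hle x')
  let w : Fin d → ℝ := fun j => s⁻¹ * φ (WithLp.toLp q (Pi.single j 1), 0)
  have hw : ∀ y : Fin d → ℝ, w ⬝ᵥ y = s⁻¹ * φ (WithLp.toLp q y, 0) := by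
    intro y
    let ψ : (Fin d → ℝ) →ₗ[ℝ] ℝ :=
      (φ : E × ℝ →ₗ[ℝ] ℝ) ∘ₗ LinearMap.inl ℝ E ℝ ∘ₗ
        (WithLp.linearEquiv q ℝ (Fin d → ℝ)).symm.toLinearMap
    have hψ : ∀ y, ψ y = φ (WithLp.toLp q y, 0) := fun y => rfl
    have h1 := LinearMap.pi_apply_eq_sum_univ ψ y
    rw [← hψ, h1, Finset.mul_sum]
    refine Finset.sum_congr rfl fun j _ => ?_
    have : (fun k => if j = k then (1 : ℝ) else 0) = Pi.single j 1 := by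
      ext k; simp [Pi.single_apply, eq_comm]
    rw [this, hψ, smul_eq_mul]
    simp only [w]
    ring
  have hsub : ∀ y : E, φ (y, 0) - φ (x', 0) = φ (y - x', 0) := by
    intro y
    rw [← map_sub]
    simp
  refine ⟨w, ?_, fun y hy => ?_⟩
  · have hne : {r : ℝ | ∃ y : Fin d → ℝ, lqNorm q y ≤ 1 ∧ r = w ⬝ᵥ y}.Nonempty :=
      ⟨0, 0, by simp [lqNorm], by simp⟩
    refine csSup_le hne ?_
    rintro r ⟨y, hy, rfl⟩
    rw [hw]
    -- Dividing by s < 0 reverses inequalities, so the upper bound on w·y comes from the direction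
    -- -y.
    have h1 := hle (x' - WithLp.toLp q y)
    rw [hux] at h1
    have h2 := hsub (x' - WithLp.toLp q y)
    have h3 : x' - WithLp.toLp q y - x' = -WithLp.toLp q y := by abel
    have h4 : φ (-WithLp.toLp q y, 0) = - φ (WithLp.toLp q y, 0) := by
      rw [← map_neg]; simp
    rw [h3, h4] at h2
    rw [h3, norm_neg] at h1
    have h5 : L * ‖WithLp.toLp q y‖ ≤ L := by
      have := mul_le_mul_of_nonneg_left (show ‖WithLp.toLp q y‖ ≤ 1 from hy) hL
      linarith
    have h6 : L * ‖WithLp.toLp q y‖ * s ≤ φ (WithLp.toLp q y, 0) := by linarith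
    have h7 : L * s ≤ φ (WithLp.toLp q y, 0) :=
      (mul_le_mul_of_nonpos_right h5 hs0.le).trans h6
    rw [inv_mul_eq_div, div_le_iff_of_neg hs0]
    exact h7
  · have h1 := hH (WithLp.toLp q y, f y - f x) ⟨hy, le_rfl⟩
    rw [hdecomp, hux] at h1
    simp only at h1
    rw [dotProduct_comm y, dotProduct_comm x, hw, hw]
    have h2 : s⁻¹ * (φ (WithLp.toLp q y, 0) + (f y - f x) * s) ≤ s⁻¹ * φ (x', 0) :=
      mul_le_mul_of_nonpos_left h1 (inv_nonpos.2 hs0.le)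
    have h3 : s⁻¹ * ((f y - f x) * s) = f y - f x := by
      rw [mul_comm, mul_assoc, mul_inv_cancel₀ hs0.ne, mul_one]
    have h4 : WithLp.toLp q x = x' := rfl
    rw [mul_add, h3] at h2
    rw [h4]
    linarith

/-- The content is boundedness, since `sSup` of an unbounded set is 0; a Lipschitz f is bounded
above on the cube. -/
lemma le_fenchel (q : ENNReal) [Fact (1 ≤ q)] {d : ℕ} {f : (Fin d → ℝ) → ℝ} {L : ℝ}
    (hL : 0 ≤ L)
    (hlip : ∀ x ∈ unitCube d, ∀ y ∈ unitCube d, f x - f y ≤ L * lqNorm q (x - y))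
    (θ : Fin d → ℝ) {y : Fin d → ℝ} (hy : y ∈ unitCube d) :
    y ⬝ᵥ θ + f y ≤ fenchel f θ := by
  refine le_csSup ?_ ⟨y, hy, rfl⟩
  refine ⟨∑ j, |θ j| + (f y + L * (1 * lqNorm q (1 : Fin d → ℝ))), ?_⟩
  rintro _ ⟨z, hz, rfl⟩
  have h1 : z ⬝ᵥ θ ≤ ∑ j, |θ j| := by
    refine Finset.sum_le_sum fun j _ => ?_
    have h0 : 0 ≤ z j := hz.1 j
    have h1 : z j ≤ 1 := hz.2 j
    calc z j * θ j ≤ z j * |θ j| := mul_le_mul_of_nonneg_left (le_abs_self _) h0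
      _ ≤ 1 * |θ j| := mul_le_mul_of_nonneg_right h1 (abs_nonneg _)
      _ = |θ j| := one_mul _
  have h2 := hlip z hz y hy
  have h3 : lqNorm q (z - y) ≤ 1 * lqNorm q (1 : Fin d → ℝ) := by
    refine lqNorm_le_of_abs_le q zero_le_one fun j => abs_le.2 ⟨?_, ?_⟩
    all_goals
      have a1 : 0 ≤ z j := hz.1 j
      have a2 : z j ≤ 1 := hz.2 j
      have a3 : 0 ≤ y j := hy.1 j
      have a4 : y j ≤ 1 := hy.2 j
      simp only [Pi.sub_apply]
      linarith
  have h4 := mul_le_mul_of_nonneg_left h3 hL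
  simp only
  linarith

/-- The regret bounds the gap between the value at a comparator dominated by every play and the
value at the average of the estimates. -/
lemma sub_le_ocoRegret_div (q : ENNReal) [Fact (1 ≤ q)] {d T : ℕ} (hT : 0 < T)
    {f : (Fin d → ℝ) → ℝ} {L : ℝ} (hL : 0 ≤ L) (hf : ConcaveOn ℝ (unitCube d) f)
    (hlip : ∀ x ∈ unitCube d, ∀ y ∈ unitCube d, f x - f y ≤ L * lqNorm q (x - y))
    {x θ : ℕ → Fin d → ℝ} (hx : avgObs T x ∈ unitCube d) {y : Fin d → ℝ}
    (hy : y ∈ unitCube d) (hmin : ∀ t < T, θ t ⬝ᵥ x t ≤ θ t ⬝ᵥ y) :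
    f y - f (avgObs T x) ≤ ocoRegret (dualBall q d L) T (fun t => dualLoss f (x t)) θ / T := by
  have hT' : (0 : ℝ) < T := by exact_mod_cast hT
  have hsum : ∀ u, ∑ t ∈ Finset.range T, dualLoss f (x t) u
      = T * (fenchel f u - u ⬝ᵥ avgObs T x) := by
    intro u
    simp only [dualLoss, Finset.sum_sub_distrib, avgObs, dotProduct_smul, dotProduct_sum,
      Finset.sum_const, Finset.card_range, nsmul_eq_mul, smul_eq_mul]
    field_simp
  rw [le_div_iff₀ hT']
  have h1 : (T : ℝ) * f y ≤ ∑ t ∈ Finset.range T, dualLoss f (x t) (θ t) := by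
    have : (T : ℝ) * f y = ∑ t ∈ Finset.range T, f y := by simp
    rw [this]
    refine Finset.sum_le_sum fun t ht => ?_
    have h1 := hmin t (Finset.mem_range.1 ht)
    have h2 := le_fenchel q hL hlip (θ t) hy
    rw [dotProduct_comm] at h2
    unfold dualLoss
    linarith
  have h2 : sInf ((fun u => ∑ t ∈ Finset.range T, dualLoss f (x t) u) '' dualBall q d L)
      ≤ T * f (avgObs T x) := by
    obtain ⟨u, hu, hu'⟩ := exists_supergradient q hL hf hlip hx
    -- Without a lower bound `sInf` would be the default 0. Every f*(w) - w·x̄ is at least f(x̄), by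
    -- taking x̄ itself in the conjugate.
    have hbdd : BddBelow ((fun u => ∑ t ∈ Finset.range T, dualLoss f (x t) u) ''
        dualBall q d L) := by
      refine ⟨T * f (avgObs T x), ?_⟩
      rintro _ ⟨w, -, rfl⟩
      simp only [hsum]
      refine mul_le_mul_of_nonneg_left ?_ hT'.le
      have := le_fenchel q hL hlip w hx
      rw [dotProduct_comm] at this
      linarith
    refine (csInf_le hbdd ⟨u, hu, rfl⟩).trans ?_
    · simp only [hsum]
      refine mul_le_mul_of_nonneg_left ?_ hT'.le
      have : fenchel f u ≤ avgObs T x ⬝ᵥ u + f (avgObs T x) := by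
        refine csSup_le (Set.Nonempty.image _ ⟨_, hx⟩) ?_
        rintro _ ⟨z, hz, rfl⟩
        exact hu' z hz
      rw [dotProduct_comm] at this
      linarith
  unfold ocoRegret
  linarith

lemma avgObs_mem_unitCube {d T : ℕ} (hT : 0 < T) {x : ℕ → Fin d → ℝ}
    (hx : ∀ t < T, x t ∈ unitCube d) : avgObs T x ∈ unitCube d := by
  have hT' : (0 : ℝ) < T := by exact_mod_cast hT
  refine ⟨fun j => ?_, fun j => ?_⟩
  all_goals simp only [avgObs, Pi.smul_apply, Finset.sum_apply, smul_eq_mul, Pi.zero_apply,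
    Pi.one_apply]
  · exact mul_nonneg (by positivity)
      (Finset.sum_nonneg fun t ht => (hx t (Finset.mem_range.1 ht)).1 j)
  · rw [inv_mul_le_iff₀ hT', mul_one]
    calc _ ≤ ∑ t ∈ Finset.range T, (1 : ℝ) :=
          Finset.sum_le_sum fun t ht => (hx t (Finset.mem_range.1 ht)).2 j
      _ = T := by simp

lemma mulVec_mem_unitCube {d m : ℕ} {A : Matrix (Fin d) (Fin m) ℝ}
    (hA : ∀ j i, A j i ∈ Set.Icc (0 : ℝ) 1) {p : Fin m → ℝ} (hp : p ∈ stdSimplex ℝ (Fin m)) :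
    A *ᵥ p ∈ unitCube d := by
  refine ⟨fun j => ?_, fun j => ?_⟩
  · exact Finset.sum_nonneg (s := Finset.univ) (f := fun i => A j i * p i)
      fun i _ => mul_nonneg (hA j i).1 (hp.1 i)
  calc ∑ i, A j i * p i ≤ ∑ i, p i :=
        Finset.sum_le_sum fun i _ => mul_le_of_le_one_left (hp.1 i) (hA j i).2
    _ = 1 := hp.2

/-- A convex combination of ε-nearest points of S is again in S, so no attained projection is
needed. -/
lemma concaveOn_neg_lqDist (q : ENNReal) [Fact (1 ≤ q)] {d : ℕ} {S : Set (Fin d → ℝ)}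
    (hS : Convex ℝ S) (hne : S.Nonempty) (K : Set (Fin d → ℝ)) (hK : Convex ℝ K) :
    ConcaveOn ℝ K (fun x => -lqDist q x S) := by
  have hS' : Convex ℝ (WithLp.toLp q '' S) :=
    hS.linear_image (WithLp.linearEquiv q ℝ (Fin d → ℝ)).symm.toLinearMap
  have hne' : (WithLp.toLp q '' S).Nonempty := hne.image _
  refine ⟨hK, fun x _ y _ a b ha hb hab => ?_⟩
  suffices h : lqDist q (a • x + b • y) S ≤ a * lqDist q x S + b * lqDist q y S by
    simp only [smul_eq_mul]
    linarith
  refine le_of_forall_pos_le_add fun ε hε => ?_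
  unfold lqDist
  obtain ⟨z, hz, hzx⟩ := (Metric.infDist_lt_iff hne').1
    (lt_add_of_pos_right (Metric.infDist (WithLp.toLp q x) (WithLp.toLp q '' S)) hε)
  obtain ⟨w, hw, hwy⟩ := (Metric.infDist_lt_iff hne').1
    (lt_add_of_pos_right (Metric.infDist (WithLp.toLp q y) (WithLp.toLp q '' S)) hε)
  refine (Metric.infDist_le_dist_of_mem (hS' hz hw ha hb hab)).trans ?_
  rw [WithLp.toLp_add, WithLp.toLp_smul, WithLp.toLp_smul]
  refine (dist_add_add_le _ _ _ _).trans ?_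
  rw [dist_smul₀, dist_smul₀, Real.norm_of_nonneg ha, Real.norm_of_nonneg hb]
  have h1 := mul_le_mul_of_nonneg_left hzx.le ha
  have h2 := mul_le_mul_of_nonneg_left hwy.le hb
  have h3 : ε = a * ε + b * ε := by rw [← add_mul, hab, one_mul]
  linarith

lemma lqDist_sub_le (q : ENNReal) [Fact (1 ≤ q)] {d : ℕ} (S : Set (Fin d → ℝ))
    (x y : Fin d → ℝ) : lqDist q x S - lqDist q y S ≤ lqNorm q (x - y) := by
  have h : lqDist q x S ≤ lqDist q y S + dist (WithLp.toLp q x) (WithLp.toLp q y) :=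
    Metric.infDist_le_infDist_add_dist
  have h2 : dist (WithLp.toLp q x) (WithLp.toLp q y) = lqNorm q (x - y) := by
    rw [dist_eq_norm]; rfl
  linarith

/-! ### Conditioning on the past, and Jensen's bound for the optimum. -/

lemma lintegral_eq_sum_fiber {Ω : Type*} [MeasurableSpace Ω] {P : Measure Ω} {m : ℕ}
    {I : Ω → Fin m} (hI : Measurable I) {F : Ω → ℝ≥0∞} (hF : Measurable F) :
    ∫⁻ ω, F ω ∂P = ∑ i, ∫⁻ ω in {ω | I ω = i}, F ω ∂P := by
  have hm : ∀ i, MeasurableSet {ω | I ω = i} := fun i => hI (measurableSet_singleton i)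
  have h : ∀ ω, F ω = ∑ i, ({ω | I ω = i} : Set Ω).indicator F ω := by
    intro ω
    simp [Set.indicator_apply]
  simp_rw [h]
  rw [lintegral_finsetSum _ fun i _ => hF.indicator (hm i)]
  refine Finset.sum_congr rfl fun i _ => ?_
  rw [lintegral_indicator (hm i)]
  refine setLIntegral_congr_fun (hm i) fun ω _ => ?_
  exact h ω

/-- Passes from events to functions in `obs_law`. On the σ-algebra of the past, restricting further
to V ∈ B only rescales the measure by ν_i(B); hence the law of V weighted by W on {I = i} is a
multiple of ν_i. -/
lemma IsInteraction.setLIntegral_mul {d m T : ℕ} {ν : Fin m → Measure (Fin d → ℝ)}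
    {Ω : Type*} [mΩ : MeasurableSpace Ω] {P : Measure Ω} {ℱ : Filtration ℕ mΩ}
    {I : ℕ → Ω → Fin m} {V : ℕ → Ω → Fin d → ℝ} (h : IsInteraction T ν P ℱ I V)
    {t : ℕ} (ht : t < T) {W : Ω → ℝ≥0∞} (hW : Measurable[ℱ t] W) (i : Fin m)
    {g : (Fin d → ℝ) → ℝ≥0∞} (hg : Measurable g) :
    ∫⁻ ω in {ω | I t ω = i}, W ω * g (V t ω) ∂P
      = (∫⁻ ω in {ω | I t ω = i}, W ω ∂P) * ∫⁻ v, g v ∂(ν i) := by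
  have hle : ℱ t ≤ mΩ := ℱ.le t
  have hWm : Measurable W := hW.mono hle le_rfl
  have hIm : Measurable (I t) := (h.arm_measurable t ht).mono (ℱ.le _) le_rfl
  have hVm : Measurable (V t) := (h.obs_measurable t ht).mono (ℱ.le _) le_rfl
  have hi : MeasurableSet {ω | I t ω = i} := hIm (measurableSet_singleton i)
  have h1 : ∀ B : Set (Fin d → ℝ), MeasurableSet B →
      ∫⁻ ω in {ω | V t ω ∈ B} ∩ {ω | I t ω = i}, W ω ∂P
        = (∫⁻ ω in {ω | I t ω = i}, W ω ∂P) * ν i B := by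
    intro B hB
    have hm : (P.restrict ({ω | V t ω ∈ B} ∩ {ω | I t ω = i})).trim hle
        = ν i B • (P.restrict {ω | I t ω = i}).trim hle := by
      refine @Measure.ext _ (ℱ t) _ _ fun A hA => ?_
      rw [Measure.smul_apply, trim_measurableSet_eq hle hA, trim_measurableSet_eq hle hA,
        Measure.restrict_apply (hle _ hA), Measure.restrict_apply (hle _ hA), smul_eq_mul,
        mul_comm, ← h.obs_law t ht A hA i B hB, Set.inter_comm {ω | V t ω ∈ B}, Set.inter_assoc]
    rw [← lintegral_trim hle hW, hm, lintegral_smul_measure, lintegral_trim hle hW, smul_eq_mul,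
      mul_comm]
  have h2 : ((P.withDensity W).restrict {ω | I t ω = i}).map (V t)
      = (∫⁻ ω in {ω | I t ω = i}, W ω ∂P) • ν i := by
    ext B hB
    rw [Measure.map_apply hVm hB, Measure.restrict_apply (hVm hB),
      withDensity_apply _ ((hVm hB).inter hi), Measure.smul_apply, smul_eq_mul, ← h1 B hB]
    rfl
  have h3 := congrArg (fun κ => ∫⁻ v, g v ∂κ) h2
  simp only [lintegral_smul_measure, smul_eq_mul] at h3
  rw [← h3, lintegral_map hg hVm]
  exact (setLIntegral_withDensity_eq_setLIntegral_mul P hWm (hg.comp hVm) hi).symm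

section

variable {d m T : ℕ} {ν : Fin m → Measure (Fin d → ℝ)} {Ω : Type*} [mΩ : MeasurableSpace Ω]
  {P : Measure Ω} {ℱ : Filtration ℕ mΩ} {I : ℕ → Ω → Fin m} {V : ℕ → Ω → Fin d → ℝ}

lemma IsInteraction.map_restrict (h : IsInteraction T ν P ℱ I V) {t : ℕ} (ht : t < T)
    (i : Fin m) : (P.restrict {ω | I t ω = i}).map (V t) = P {ω | I t ω = i} • ν i := by
  have hVm : Measurable (V t) := (h.obs_measurable t ht).mono (ℱ.le _) le_rfl
  ext B hB
  rw [Measure.map_apply hVm hB, Measure.restrict_apply (hVm hB), Measure.smul_apply, smul_eq_mul]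
  have := h.obs_law t ht Set.univ MeasurableSet.univ i B hB
  rw [Set.univ_inter, Set.inter_comm] at this
  exact this

lemma IsInteraction.integrable_obs [IsFiniteMeasure P] (h : IsInteraction T ν P ℱ I V) {t : ℕ}
    (ht : t < T) (j : Fin d) : Integrable (fun ω => V t ω j) P := by
  have hVm : Measurable (V t) := (h.obs_measurable t ht).mono (ℱ.le _) le_rfl
  refine Integrable.of_bound ((measurable_pi_apply j).comp hVm).aestronglyMeasurable 1
    (ae_of_all _ fun ω => ?_)
  have := h.obs_mem t ht ω
  rw [Real.norm_eq_abs, abs_of_nonneg (this.1 j)]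
  exact this.2 j

lemma IsInteraction.integral_obs [IsProbabilityMeasure P] (h : IsInteraction T ν P ℱ I V) {t : ℕ}
    (ht : t < T) (j : Fin d) :
    ∫ ω, V t ω j ∂P = ∑ i, meanMatrix ν j i * P.real {ω | I t ω = i} := by
  have hVm : Measurable (V t) := (h.obs_measurable t ht).mono (ℱ.le _) le_rfl
  have hIm : Measurable (I t) := (h.arm_measurable t ht).mono (ℱ.le _) le_rfl
  have hi : ∀ i, MeasurableSet {ω | I t ω = i} := fun i => hIm (measurableSet_singleton i)
  have hs : ∀ ω, V t ω j = ∑ i, ({ω | I t ω = i} : Set Ω).indicator (fun ω => V t ω j) ω := by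
    intro ω
    simp [Set.indicator_apply]
  rw [integral_congr_ae (ae_of_all _ hs),
    integral_finsetSum _ fun i _ => (h.integrable_obs ht j).indicator (hi i)]
  refine Finset.sum_congr rfl fun i _ => ?_
  rw [integral_indicator (hi i)]
  have h1 : ∫ ω in {ω | I t ω = i}, V t ω j ∂P
      = ∫ v, v j ∂((P.restrict {ω | I t ω = i}).map (V t)) := by
    rw [integral_map hVm.aemeasurable (measurable_pi_apply j).aestronglyMeasurable]
  rw [h1, h.map_restrict ht, integral_smul_measure]
  simp [meanMatrix, Measure.real, mul_comm]

lemma continuousOn_of_lqNorm_lipschitz (q : ENNReal) [Fact (1 ≤ q)] {d : ℕ}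
    {f : (Fin d → ℝ) → ℝ} {L : ℝ} (hL : 0 ≤ L) {K : Set (Fin d → ℝ)}
    (hlip : ∀ x ∈ K, ∀ y ∈ K, f x - f y ≤ L * lqNorm q (x - y)) : ContinuousOn f K := by
  have hd : ∀ x y : Fin d → ℝ, lqNorm q (x - y) ≤ dist x y * lqNorm q (1 : Fin d → ℝ) :=
    fun x y => lqNorm_le_of_abs_le q dist_nonneg fun j => by
      simpa [Real.dist_eq] using dist_le_pi_dist x y j
  have h1 : 0 ≤ lqNorm q (1 : Fin d → ℝ) := norm_nonneg _
  refine (LipschitzOnWith.of_dist_le_mul (K := ⟨L * lqNorm q (1 : Fin d → ℝ), by positivity⟩)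
    fun x hx y hy => ?_).continuousOn
  have key : ∀ x ∈ K, ∀ y ∈ K, f x - f y ≤ L * lqNorm q (1 : Fin d → ℝ) * dist x y := by
    intro x hx y hy
    calc f x - f y ≤ L * lqNorm q (x - y) := hlip x hx y hy
      _ ≤ L * (dist x y * lqNorm q (1 : Fin d → ℝ)) := mul_le_mul_of_nonneg_left (hd x y) hL
      _ = _ := by ring
  rw [Real.dist_eq, abs_le]
  refine ⟨?_, key x hx y hy⟩
  have := key y hy x hx
  rw [dist_comm] at this
  change -(L * lqNorm q (1 : Fin d → ℝ) * dist x y) ≤ _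
  linarith

lemma meanMatrix_mem_Icc (hν : ∀ i, IsProbabilityMeasure (ν i))
    (hcube : ∀ i, ∀ᵐ v ∂(ν i), v ∈ unitCube d) (j : Fin d) (i : Fin m) :
    meanMatrix ν j i ∈ Set.Icc (0 : ℝ) 1 := by
  have := hν i
  have h0 : 0 ≤ᵐ[ν i] fun v => v j := by
    filter_upwards [hcube i] with v hv using hv.1 j
  have h1 : (fun v : Fin d → ℝ => v j) ≤ᵐ[ν i] fun _ => 1 := by
    filter_upwards [hcube i] with v hv using hv.2 j
  refine ⟨integral_nonneg_of_ae h0, ?_⟩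
  have := integral_mono_of_nonneg h0 (integrable_const 1) h1
  simpa [meanMatrix] using this

/-- The expected reward of a policy is at most the reward of its expected arm frequencies. -/
lemma IsInteraction.integral_le [IsProbabilityMeasure P] (h : IsInteraction T ν P ℱ I V)
    (hT : 0 < T) {f : (Fin d → ℝ) → ℝ} (hf : ConcaveOn ℝ (unitCube d) f)
    (hfc : ContinuousOn f (unitCube d)) (hf0 : ∀ x ∈ unitCube d, 0 ≤ f x)
    (hμ : ∀ j i, meanMatrix ν j i ∈ Set.Icc (0 : ℝ) 1) :
    ∃ p ∈ stdSimplex ℝ (Fin m),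
      ∫ ω, f (avgObs T fun t => V t ω) ∂P ≤ f (meanMatrix ν *ᵥ p) := by
  have hT' : (0 : ℝ) < T := by exact_mod_cast hT
  -- The expected fraction of rounds spent on each arm; the mean of the average observation is then
  -- μp.
  let p : Fin m → ℝ := fun i => (T : ℝ)⁻¹ * ∑ t ∈ Finset.range T, P.real {ω | I t ω = i}
  have hp : p ∈ stdSimplex ℝ (Fin m) := by
    refine ⟨fun i => by positivity, ?_⟩
    simp only [p]
    rw [← Finset.mul_sum, Finset.sum_comm]
    have : ∀ t ∈ Finset.range T, ∑ i, P.real {ω | I t ω = i} = 1 := by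
      intro t ht
      have hIm : Measurable (I t) :=
        (h.arm_measurable t (Finset.mem_range.1 ht)).mono (ℱ.le _) le_rfl
      have h1 := lintegral_eq_sum_fiber (P := P) hIm (F := fun _ => 1) measurable_const
      simp only [lintegral_const, measure_univ, mul_one, one_mul, Measure.restrict_apply,
        MeasurableSet.univ, Set.univ_inter] at h1
      simp only [Measure.real]
      rw [← ENNReal.toReal_sum fun i _ => measure_ne_top _ _, ← h1, ENNReal.toReal_one]
    rw [Finset.sum_congr rfl this]
    simp [hT'.ne']
  refine ⟨p, hp, ?_⟩
  have hav : ∀ ω, avgObs T (fun t => V t ω) ∈ unitCube d :=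
    fun ω => avgObs_mem_unitCube hT fun t ht => h.obs_mem t ht ω
  have hcomp : ∀ j, Integrable (fun ω => avgObs T (fun t => V t ω) j) P := by
    intro j
    simp only [avgObs, Pi.smul_apply, Finset.sum_apply, smul_eq_mul]
    exact (integrable_finsetSum _ fun t ht =>
      h.integrable_obs (Finset.mem_range.1 ht) j).const_mul _
  have hint : Integrable (fun ω => avgObs T fun t => V t ω) P := Integrable.of_eval hcomp
  have hmean : ∫ ω, avgObs T (fun t => V t ω) ∂P = meanMatrix ν *ᵥ p := by
    ext j
    rw [eval_integral hcomp]
    simp only [avgObs, Pi.smul_apply, Finset.sum_apply, smul_eq_mul]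
    rw [integral_const_mul, integral_finsetSum _ fun t ht =>
      h.integrable_obs (Finset.mem_range.1 ht) j,
      Finset.sum_congr rfl fun t ht => h.integral_obs (Finset.mem_range.1 ht) j]
    simp only [mulVec, dotProduct, p]
    rw [Finset.sum_comm, Finset.mul_sum]
    refine Finset.sum_congr rfl fun i _ => ?_
    rw [← Finset.mul_sum]
    ring
  -- A non-integrable reward has Bochner integral 0, which is harmless because f ≥ 0 on the cube.
  by_cases hfi : Integrable (fun ω => f (avgObs T fun t => V t ω)) P
  · rw [← hmean]
    exact hf.le_map_integral hfc isClosed_Icc (ae_of_all _ hav) hint hfi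
  · rw [integral_undef hfi]
    exact hf0 _ (mulVec_mem_unitCube hμ hp)

end

/-- Nonnegativity of b covers the default value 0 of `sSup` on the empty set. -/
lemma optValue_le {d m T : ℕ} {ν : Fin m → Measure (Fin d → ℝ)} (hT : 0 < T)
    {f : (Fin d → ℝ) → ℝ} (hf : ConcaveOn ℝ (unitCube d) f)
    (hfc : ContinuousOn f (unitCube d)) (hf0 : ∀ x ∈ unitCube d, 0 ≤ f x)
    (hμ : ∀ j i, meanMatrix ν j i ∈ Set.Icc (0 : ℝ) 1) {b : ℝ} (hb0 : 0 ≤ b)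
    (hb : ∀ p ∈ stdSimplex ℝ (Fin m), f (meanMatrix ν *ᵥ p) ≤ b) : optValue T ν f ≤ b := by
  refine Real.sSup_le ?_ hb0
  rintro r ⟨Ω, mΩ, P, ℱ, I, V, hP, h, rfl⟩
  obtain ⟨p, hp, hle⟩ := h.integral_le hT hf hfc hf0 hμ
  exact hle.trans (hb p hp)

/-! ### Exponential moments and supermartingale tails. -/

/-- From e^x ≤ 1 + x + x² for |x| ≤ 1 and a² ≤ a. Linearity in a is the point: expectations then
involve only the mean, with variance proxy l² times the mean. -/
lemma exp_mul_le {l a : ℝ} (hl : |l| ≤ 1) (ha : a ∈ Set.Icc (0 : ℝ) 1) :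
    Real.exp (l * a) ≤ 1 + (l + l ^ 2) * a := by
  have h1 : |l * a| ≤ 1 := by
    rw [abs_mul, abs_of_nonneg ha.1]
    exact mul_le_one₀ hl ha.1 ha.2
  have h2 := (abs_le.1 (Real.abs_exp_sub_one_sub_id_le h1)).2
  have h3 : (l * a) ^ 2 ≤ l ^ 2 * a := by
    rw [mul_pow]
    exact mul_le_mul_of_nonneg_left (by nlinarith [ha.1, ha.2]) (sq_nonneg l)
  linarith

/-- Bennett-type bound for the exponential moment of a `[0,1]`-valued random variable. -/
lemma lintegral_exp_le_one {Ω : Type*} [MeasurableSpace Ω] {P : Measure Ω}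
    [IsProbabilityMeasure P] {X : Ω → ℝ} (hX : Measurable X)
    (hX01 : ∀ᵐ ω ∂P, X ω ∈ Set.Icc (0 : ℝ) 1) {l : ℝ} (hl : |l| ≤ 1) :
    ∫⁻ ω, ENNReal.ofReal (Real.exp (l * (X ω - ∫ ω, X ω ∂P) - l ^ 2 * ∫ ω, X ω ∂P)) ∂P ≤ 1 := by
  set μ := ∫ ω, X ω ∂P with hμ
  have hXi : Integrable X P := Integrable.of_bound hX.aestronglyMeasurable 1 (by
    filter_upwards [hX01] with ω h
    rw [Real.norm_eq_abs, abs_of_nonneg h.1]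
    exact h.2)
  have hle : ∀ᵐ ω ∂P, ENNReal.ofReal (Real.exp (l * (X ω - μ) - l ^ 2 * μ))
      ≤ ENNReal.ofReal (Real.exp (-(l + l ^ 2) * μ) * (1 + (l + l ^ 2) * X ω)) := by
    filter_upwards [hX01] with ω h
    refine ENNReal.ofReal_le_ofReal ?_
    have : l * (X ω - μ) - l ^ 2 * μ = -(l + l ^ 2) * μ + l * X ω := by ring
    rw [this, Real.exp_add]
    exact mul_le_mul_of_nonneg_left (exp_mul_le hl h) (Real.exp_pos _).le
  refine (lintegral_mono_ae hle).trans ?_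
  have hi : Integrable (fun ω => 1 + (l + l ^ 2) * X ω) P :=
    (integrable_const 1).add (hXi.const_mul _)
  rw [← ofReal_integral_eq_lintegral_ofReal (hi.const_mul _) (by
    filter_upwards [hX01] with ω h
    exact mul_nonneg (Real.exp_pos _).le ((Real.exp_pos _).le.trans (exp_mul_le hl h)))]
  rw [integral_const_mul, integral_add (integrable_const 1) (hXi.const_mul _),
    integral_const_mul, ← hμ]
  refine ENNReal.ofReal_le_one.2 ?_
  have h1 : 1 + (l + l ^ 2) * μ ≤ Real.exp ((l + l ^ 2) * μ) := by
    have := Real.add_one_le_exp ((l + l ^ 2) * μ)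
    linarith
  calc _ ≤ Real.exp (-(l + l ^ 2) * μ) * Real.exp ((l + l ^ 2) * μ) :=
        mul_le_mul_of_nonneg_left (by simpa using h1) (Real.exp_pos _).le
    _ = 1 := by
        rw [← Real.exp_add, ← Real.exp_zero]
        congr 1
        ring

/-- The analogue for drawing an arm from p. The mean a·p is bounded by 1 in the compensator, which
becomes the constant l² in every round. -/
lemma sum_mul_exp_le_one {m : ℕ} {p a : Fin m → ℝ} (hp : p ∈ stdSimplex ℝ (Fin m))
    (ha : ∀ i, a i ∈ Set.Icc (0 : ℝ) 1) {l : ℝ} (hl : |l| ≤ 1) :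
    ∑ i, p i * Real.exp (l * (a i - a ⬝ᵥ p) - l ^ 2) ≤ 1 := by
  have hap : a ⬝ᵥ p ≤ 1 := by
    calc a ⬝ᵥ p ≤ ∑ i, p i := Finset.sum_le_sum fun i _ => mul_le_of_le_one_left (hp.1 i) (ha i).2
      _ = 1 := hp.2
  have h1 : ∀ i, p i * Real.exp (l * (a i - a ⬝ᵥ p) - l ^ 2)
      ≤ Real.exp (-(l * (a ⬝ᵥ p)) - l ^ 2) * (p i + (l + l ^ 2) * (a i * p i)) := by
    intro i
    have : l * (a i - a ⬝ᵥ p) - l ^ 2 = (-(l * (a ⬝ᵥ p)) - l ^ 2) + l * a i := by ring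
    rw [this, Real.exp_add]
    have h2 := mul_le_mul_of_nonneg_left (exp_mul_le hl (ha i)) (hp.1 i)
    have h3 := mul_le_mul_of_nonneg_left h2 (Real.exp_pos (-(l * (a ⬝ᵥ p)) - l ^ 2)).le
    linarith
  refine (Finset.sum_le_sum fun i _ => h1 i).trans ?_
  rw [← Finset.mul_sum, Finset.sum_add_distrib, ← Finset.mul_sum, hp.2]
  change _ * (1 + (l + l ^ 2) * (a ⬝ᵥ p)) ≤ 1
  have h2 : 1 + (l + l ^ 2) * (a ⬝ᵥ p) ≤ Real.exp (l * (a ⬝ᵥ p) + l ^ 2) := by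
    have h3 := Real.add_one_le_exp (l * (a ⬝ᵥ p) + l ^ 2)
    have h4 := mul_le_mul_of_nonneg_left hap (sq_nonneg l)
    linarith
  calc _ ≤ Real.exp (-(l * (a ⬝ᵥ p)) - l ^ 2) * Real.exp (l * (a ⬝ᵥ p) + l ^ 2) :=
        mul_le_mul_of_nonneg_left h2 (Real.exp_pos _).le
    _ = 1 := by
        rw [← Real.exp_add, ← Real.exp_zero]
        congr 1
        ring

/-- Exponential supermartingale tail bound. -/
lemma measure_le_sum_le_exp_neg {Ω : Type*} [mΩ : MeasurableSpace Ω] {P : Measure Ω}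
    [IsProbabilityMeasure P] {ℱ : Filtration ℕ mΩ} {T : ℕ} {X : ℕ → Ω → ℝ}
    (hX : ∀ t < T, Measurable[ℱ (t + 1)] (X t))
    (hE : ∀ t < T, ∀ W : Ω → ℝ≥0∞, Measurable[ℱ t] W →
      ∫⁻ ω, W ω * ENNReal.ofReal (Real.exp (X t ω)) ∂P ≤ ∫⁻ ω, W ω ∂P)
    {n : ℕ} (hn : n ≤ T) (g : ℝ) :
    P {ω | g ≤ ∑ t ∈ Finset.range n, X t ω} ≤ ENNReal.ofReal (Real.exp (-g)) := by
  have hmeas : ∀ n ≤ T, Measurable[ℱ n] fun ω =>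
      ENNReal.ofReal (Real.exp (∑ t ∈ Finset.range n, X t ω)) := by
    intro n hn
    refine ENNReal.measurable_ofReal.comp (Real.measurable_exp.comp ?_)
    exact Finset.measurable_fun_sum _ fun t ht => by
      have ht' := Finset.mem_range.1 ht
      exact (hX t (by omega)).mono (ℱ.mono (by omega)) le_rfl
  -- The exponential of the first n increments is the weight W to which the one-step bound applies.
  have hone : ∀ n ≤ T, ∫⁻ ω, ENNReal.ofReal (Real.exp (∑ t ∈ Finset.range n, X t ω)) ∂P ≤ 1 := by
    intro n
    induction n with
    | zero => simp
    | succ n ih =>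
      intro hn
      refine le_trans (le_of_eq ?_) ((hE n (by omega) _ (hmeas n (by omega))).trans
        (ih (by omega)))
      refine lintegral_congr fun ω => ?_
      rw [Finset.sum_range_succ, Real.exp_add, ENNReal.ofReal_mul (Real.exp_pos _).le]
  have hm := (hmeas n hn).mono (ℱ.le n) le_rfl
  have hset : {ω | g ≤ ∑ t ∈ Finset.range n, X t ω}
      = {ω | ENNReal.ofReal (Real.exp g) ≤
          ENNReal.ofReal (Real.exp (∑ t ∈ Finset.range n, X t ω))} := by
    ext ω
    simp only [Set.mem_ofPred_eq]
    rw [ENNReal.ofReal_le_ofReal_iff (Real.exp_pos _).le, Real.exp_le_exp]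
  have h1 := mul_meas_ge_le_lintegral (μ := P) hm (ENNReal.ofReal (Real.exp g))
  rw [← hset] at h1
  have h2 := mul_le_mul_right (h1.trans (hone n hn)) (ENNReal.ofReal (Real.exp (-g)))
  rw [← mul_assoc, ← ENNReal.ofReal_mul (Real.exp_pos _).le, ← Real.exp_add, neg_add_cancel,
    Real.exp_zero, ENNReal.ofReal_one, one_mul, mul_one] at h2
  exact h2

section

variable {d m T : ℕ} {ν : Fin m → Measure (Fin d → ℝ)} {Ω : Type*} [mΩ : MeasurableSpace Ω]
  {P : Measure Ω} {ℱ : Filtration ℕ mΩ}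
  {I : ℕ → Ω → Fin m} {V : ℕ → Ω → Fin d → ℝ}

/-- The sum of component `j` of the observations from arm `i` before round `t`. -/
def obsSum (I : ℕ → Fin m) (V : ℕ → Fin d → ℝ) (t : ℕ) (j : Fin d) (i : Fin m) : ℝ :=
  ∑ s ∈ Finset.range t with I s = i, V s j

lemma IsInteraction.measure_obsSum_le [IsProbabilityMeasure P] (h : IsInteraction T ν P ℱ I V)
    (hν : ∀ i, IsProbabilityMeasure (ν i)) (hcube : ∀ i, ∀ᵐ v ∂(ν i), v ∈ unitCube d)
    {l : ℝ} (hl : |l| ≤ 1) (j : Fin d) (i : Fin m) {t : ℕ} (ht : t ≤ T) (g : ℝ) :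
    P {ω | g ≤ l * (obsSum (fun s => I s ω) (fun s => V s ω) t j i
        - plays (fun s => I s ω) t i * meanMatrix ν j i)
        - l ^ 2 * (plays (fun s => I s ω) t i * meanMatrix ν j i)}
      ≤ ENNReal.ofReal (Real.exp (-g)) := by
  set μ := meanMatrix ν j i with hμ
  -- Increments vanish when another arm is played, so a sum to a fixed time t handles the random
  -- number of plays without stopping times.
  let X : ℕ → Ω → ℝ := fun s ω => if I s ω = i then l * (V s ω j - μ) - l ^ 2 * μ else 0
  have hXm : ∀ s < T, Measurable[ℱ (s + 1)] (X s) := by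
    intro s hs
    refine Measurable.ite (h.arm_measurable s hs (measurableSet_singleton i)) ?_ measurable_const
    exact ((((measurable_pi_apply j).comp (h.obs_measurable s hs)).sub_const _).const_mul
      _).sub_const _
  have hXE : ∀ s < T, ∀ W : Ω → ℝ≥0∞, Measurable[ℱ s] W →
      ∫⁻ ω, W ω * ENNReal.ofReal (Real.exp (X s ω)) ∂P ≤ ∫⁻ ω, W ω ∂P := by
    intro s hs W hW
    have hIm : Measurable (I s) := (h.arm_measurable s hs).mono (ℱ.le _) le_rfl
    have hi : ∀ i, MeasurableSet {ω | I s ω = i} := fun i => hIm (measurableSet_singleton i)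
    have hWm : Measurable W := hW.mono (ℱ.le _) le_rfl
    have hXm' : Measurable (X s) := (hXm s hs).mono (ℱ.le _) le_rfl
    rw [lintegral_eq_sum_fiber hIm
      (F := fun ω => W ω * ENNReal.ofReal (Real.exp (X s ω))) (hWm.mul hXm'.exp.ennreal_ofReal),
      lintegral_eq_sum_fiber hIm hWm]
    refine Finset.sum_le_sum fun i' _ => ?_
    by_cases hii : i' = i
    · subst hii
      have h1 : ∫⁻ ω in {ω | I s ω = i'}, W ω * ENNReal.ofReal (Real.exp (X s ω)) ∂P
          = ∫⁻ ω in {ω | I s ω = i'}, W ω *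
            (fun v : Fin d → ℝ =>
              ENNReal.ofReal (Real.exp (l * (v j - μ) - l ^ 2 * μ))) (V s ω) ∂P :=
        setLIntegral_congr_fun (hi i') fun ω hω => by
          have : I s ω = i' := hω
          simp only [X, this, if_true]
      rw [h1, h.setLIntegral_mul hs hW i'
        (g := fun v => ENNReal.ofReal (Real.exp (l * (v j - μ) - l ^ 2 * μ))) (by fun_prop)]
      have := hν i'
      have h2 : ∫⁻ v, ENNReal.ofReal (Real.exp (l * (v j - μ) - l ^ 2 * μ)) ∂(ν i') ≤ 1 :=
        lintegral_exp_le_one (measurable_pi_apply j)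
          ((hcube i').mono fun v hv => ⟨hv.1 j, hv.2 j⟩) hl
      exact mul_le_of_le_one_right' h2
    · refine le_of_eq (setLIntegral_congr_fun (hi i') fun ω hω => ?_)
      have : I s ω = i' := hω
      simp only [X, this, hii, if_false, Real.exp_zero, ENNReal.ofReal_one, mul_one]
  have hsum : ∀ ω, ∑ s ∈ Finset.range t, X s ω
      = l * (obsSum (fun s => I s ω) (fun s => V s ω) t j i - plays (fun s => I s ω) t i * μ)
        - l ^ 2 * (plays (fun s => I s ω) t i * μ) := by
    intro ω
    simp only [X, obsSum, plays]
    rw [← Finset.sum_filter, Finset.sum_sub_distrib, ← Finset.mul_sum, Finset.sum_sub_distrib]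
    simp only [Finset.sum_const, nsmul_eq_mul]
    ring
  have := measure_le_sum_le_exp_neg hXm hXE ht g
  simpa only [hsum] using this

/-- On events of the past, the indicator of {I = i} and the density p_i define the same measure, so
they integrate past-measurable functions alike. -/
lemma setLIntegral_arm_eq {I : Ω → Fin m} {t : ℕ}
    {p : Ω → Fin m → ℝ} (hp : Measurable[ℱ t] p) {i : Fin m}
    (hlaw : ∀ A : Set Ω, MeasurableSet[ℱ t] A →
      P (A ∩ {ω | I ω = i}) = ∫⁻ ω in A, ENNReal.ofReal (p ω i) ∂P)
    {W : Ω → ℝ≥0∞} (hW : Measurable[ℱ t] W) :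
    ∫⁻ ω in {ω | I ω = i}, W ω ∂P = ∫⁻ ω, ENNReal.ofReal (p ω i) * W ω ∂P := by
  have hle : ℱ t ≤ mΩ := ℱ.le t
  have hpi : Measurable fun ω => ENNReal.ofReal (p ω i) :=
    (((measurable_pi_apply i).comp hp).mono hle le_rfl).ennreal_ofReal
  have hm : (P.restrict {ω | I ω = i}).trim hle
      = (P.withDensity fun ω => ENNReal.ofReal (p ω i)).trim hle := by
    refine @Measure.ext _ (ℱ t) _ _ fun A hA => ?_
    rw [trim_measurableSet_eq hle hA, trim_measurableSet_eq hle hA,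
      Measure.restrict_apply (hle _ hA), withDensity_apply _ (hle _ hA), hlaw A hA]
  rw [← lintegral_trim hle hW, hm, lintegral_trim hle hW,
    lintegral_withDensity_eq_lintegral_mul _ hpi (hW.mono hle le_rfl)]
  rfl

lemma measure_sum_est_sub_le [IsProbabilityMeasure P]
    (hI : ∀ t < T, Measurable[ℱ (t + 1)] (I t))
    {p : ℕ → Ω → Fin m → ℝ} (hp : ∀ t < T, Measurable[ℱ t] (p t))
    (hp1 : ∀ t < T, ∀ ω, p t ω ∈ stdSimplex ℝ (Fin m))
    (hlaw : ∀ t < T, ∀ A : Set Ω, MeasurableSet[ℱ t] A → ∀ i : Fin m,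
      P (A ∩ {ω | I t ω = i}) = ∫⁻ ω in A, ENNReal.ofReal (p t ω i) ∂P)
    {a : ℕ → Ω → Fin m → ℝ} (ha : ∀ t < T, ∀ i, Measurable[ℱ t] fun ω => a t ω i)
    (ha1 : ∀ t < T, ∀ ω i, a t ω i ∈ Set.Icc (0 : ℝ) 1) {l : ℝ} (hl : |l| ≤ 1) (g : ℝ) :
    P {ω | g ≤ ∑ t ∈ Finset.range T, (l * (a t ω (I t ω) - a t ω ⬝ᵥ p t ω) - l ^ 2)}
      ≤ ENNReal.ofReal (Real.exp (-g)) := by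
  have hbm : ∀ t < T, ∀ i, Measurable[ℱ t] fun ω => l * (a t ω i - a t ω ⬝ᵥ p t ω) - l ^ 2 := by
    intro t ht i
    refine (((ha t ht i).sub ?_).const_mul _).sub_const _
    exact Finset.measurable_fun_sum _ fun i _ =>
      (ha t ht i).mul ((measurable_pi_apply i).comp (hp t ht))
  have hXm : ∀ t < T, Measurable[ℱ (t + 1)] fun ω =>
      l * (a t ω (I t ω) - a t ω ⬝ᵥ p t ω) - l ^ 2 := by
    intro t ht
    -- Expanding over the finitely many arms gives measurability despite the random index.
    have : (fun ω => l * (a t ω (I t ω) - a t ω ⬝ᵥ p t ω) - l ^ 2)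
        = fun ω => ∑ i, if I t ω = i then l * (a t ω i - a t ω ⬝ᵥ p t ω) - l ^ 2 else 0 := by
      ext ω
      simp
    rw [this]
    refine Finset.measurable_fun_sum _ fun i _ => ?_
    exact Measurable.ite (hI t ht (measurableSet_singleton i))
      ((hbm t ht i).mono (ℱ.mono (Nat.le_succ t)) le_rfl) measurable_const
  refine measure_le_sum_le_exp_neg hXm (fun t ht W hW => ?_) le_rfl g
  have hIm : Measurable (I t) := (hI t ht).mono (ℱ.le _) le_rfl
  have hi : ∀ i, MeasurableSet {ω | I t ω = i} := fun i => hIm (measurableSet_singleton i)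
  have hWm : Measurable W := hW.mono (ℱ.le _) le_rfl
  have hWi : ∀ i, Measurable[ℱ t] fun ω =>
      W ω * ENNReal.ofReal (Real.exp (l * (a t ω i - a t ω ⬝ᵥ p t ω) - l ^ 2)) :=
    fun i => hW.mul (hbm t ht i).exp.ennreal_ofReal
  rw [lintegral_eq_sum_fiber hIm
    (F := fun ω =>
      W ω * ENNReal.ofReal (Real.exp (l * (a t ω (I t ω) - a t ω ⬝ᵥ p t ω) - l ^ 2)))
    (hWm.mul ((hXm t ht).mono (ℱ.le _) le_rfl).exp.ennreal_ofReal)]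
  have h1 : ∀ i, ∫⁻ ω in {ω | I t ω = i},
        W ω * ENNReal.ofReal (Real.exp (l * (a t ω (I t ω) - a t ω ⬝ᵥ p t ω) - l ^ 2)) ∂P
      = ∫⁻ ω, ENNReal.ofReal (p t ω i) *
        (W ω * ENNReal.ofReal (Real.exp (l * (a t ω i - a t ω ⬝ᵥ p t ω) - l ^ 2))) ∂P := by
    intro i
    rw [← setLIntegral_arm_eq (hp t ht) (fun A hA => hlaw t ht A hA i) (hWi i)]
    refine setLIntegral_congr_fun (hi i) fun ω hω => ?_
    have : I t ω = i := hω
    simp only [this]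
  rw [Finset.sum_congr rfl fun i _ => h1 i, ← lintegral_finsetSum]
  · refine lintegral_mono fun ω => ?_
    have h2 := sum_mul_exp_le_one (hp1 t ht ω) (ha1 t ht ω) hl
    calc _ = W ω * ENNReal.ofReal
          (∑ i, p t ω i * Real.exp (l * (a t ω i - a t ω ⬝ᵥ p t ω) - l ^ 2)) := by
          rw [ENNReal.ofReal_sum_of_nonneg fun i _ =>
            mul_nonneg ((hp1 t ht ω).1 i) (Real.exp_pos _).le, Finset.mul_sum]
          refine Finset.sum_congr rfl fun i _ => ?_
          rw [ENNReal.ofReal_mul ((hp1 t ht ω).1 i)]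
          ring
      _ ≤ W ω := mul_le_of_le_one_right' (ENNReal.ofReal_le_one.2 h2)
  · intro i _
    exact (((measurable_pi_apply i).comp (hp t ht)).mono (ℱ.le t) le_rfl).ennreal_ofReal.mul
      ((hWi i).mono (ℱ.le t) le_rfl)

end

/-! ### From tail bounds to confidence radii. -/

/-- The exponent that balances `l * y` against `g / l`, subject to `l ≤ 1`. -/
def tuning (g y : ℝ) : ℝ := if y ≤ g then 1 else Real.sqrt (g / y)

lemma tuning_pos {g y : ℝ} (hg : 0 < g) : 0 < tuning g y := by
  unfold tuning
  split_ifs with h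
  · exact one_pos
  · exact Real.sqrt_pos.2 (div_pos hg (hg.trans (not_le.1 h)))

lemma tuning_le_one {g y : ℝ} (hg : 0 < g) : tuning g y ≤ 1 := by
  unfold tuning
  split_ifs with h
  · exact le_rfl
  · have h' := not_le.1 h
    exact Real.sqrt_le_one.2 ((div_le_one (hg.trans h')).2 h'.le)

lemma le_of_tuning {g y x : ℝ} (hg : 0 < g)
    (h : tuning g y * x - tuning g y ^ 2 * y < g) : x ≤ 2 * Real.sqrt (g * y) + 2 * g := by
  have hs := Real.sqrt_nonneg (g * y)
  unfold tuning at h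
  split_ifs at h with hyg
  · linarith
  · have hy : 0 < y := hg.trans (not_le.1 hyg)
    rw [Real.sq_sqrt (div_pos hg hy).le, div_mul_cancel₀ _ hy.ne'] at h
    have h1 : Real.sqrt (g / y) * Real.sqrt (g * y) = g := by
      rw [← Real.sqrt_mul (div_pos hg hy).le]
      have : g / y * (g * y) = g ^ 2 := by field_simp
      rw [this, Real.sqrt_sq hg.le]
    have h2 : Real.sqrt (g / y) * x < Real.sqrt (g / y) * (2 * Real.sqrt (g * y)) := by linarith
    have h3 := lt_of_mul_lt_mul_left h2 (Real.sqrt_nonneg _)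
    linarith

lemma sqrt_sixteen_mul (x : ℝ) : Real.sqrt (16 * x) = 4 * Real.sqrt x := by
  rw [Real.sqrt_mul (by norm_num), show (16 : ℝ) = 4 ^ 2 by norm_num,
    Real.sqrt_sq (by norm_num)]

lemma rad_div_eq {γ S N : ℝ} (hN : 0 < N) :
    rad γ (S / N) N = (Real.sqrt (γ * S) + γ) / N := by
  have : γ * (S / N) / N = γ * S / N ^ 2 := by field_simp
  unfold rad
  rw [this, Real.sqrt_div' _ (sq_nonneg N), Real.sqrt_sq hN.le, add_div]

/-- Replaces the unknown kμ under the root by the observed S: with D the deviation, √(g·kμ) ≤ √(gS)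
+ √(gD) and √(gD) ≤ g + D/4, so half of D is absorbed and D ≤ 4√(gS) + 8g. The denominator k + 1
costs an extra μ ≤ 1 ≤ 8g. -/
lemma abs_div_sub_le_rad {g S k μ : ℝ} (hg : 1 ≤ 8 * g) (hS : 0 ≤ S) (hk : 0 ≤ k)
    (hμ : μ ∈ Set.Icc (0 : ℝ) 1) (h : |S - k * μ| ≤ 2 * Real.sqrt (g * (k * μ)) + 2 * g) :
    |S / (k + 1) - μ| ≤ 2 * rad (16 * g) (S / (k + 1)) (k + 1) := by
  have hN : 0 < k + 1 := by linarith
  have hg0 : 0 ≤ g := by linarith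
  rw [rad_div_eq hN]
  set D := |S - k * μ| with hD
  have hD0 : 0 ≤ D := abs_nonneg _
  have h1 : k * μ ≤ S + D := by
    have := neg_abs_le (S - k * μ)
    linarith
  have h2 : Real.sqrt (g * (k * μ)) ≤ Real.sqrt (g * S) + Real.sqrt (g * D) := by
    refine (Real.sqrt_le_sqrt (mul_le_mul_of_nonneg_left h1 hg0)).trans ?_
    rw [mul_add]
    refine Real.sqrt_le_iff.2 ⟨by positivity, ?_⟩
    have e1 := Real.sq_sqrt (mul_nonneg hg0 hS)
    have e2 := Real.sq_sqrt (mul_nonneg hg0 hD0)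
    have e3 := mul_nonneg (Real.sqrt_nonneg (g * S)) (Real.sqrt_nonneg (g * D))
    linear_combination 2 * e3 - e1 - e2
  have h3 : Real.sqrt (g * D) ≤ g + D / 4 := by
    refine Real.sqrt_le_iff.2 ⟨by positivity, ?_⟩
    nlinarith [sq_nonneg (g - D / 4)]
  have h4 : Real.sqrt (16 * g * S) = 4 * Real.sqrt (g * S) := by
    rw [mul_assoc, sqrt_sixteen_mul]
  have h5 : |S / (k + 1) - μ| = |(S - k * μ) - μ| / (k + 1) := by
    rw [← abs_of_pos hN, ← abs_div, abs_of_pos hN]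
    congr 1
    field_simp
    ring
  have h6 : |(S - k * μ) - μ| ≤ D + μ := (abs_sub _ _).trans (by rw [abs_of_nonneg hμ.1])
  have h7 := Real.sqrt_nonneg (g * S)
  rw [h5, h4, mul_div_assoc']
  refine div_le_div_of_nonneg_right ?_ hN.le
  have := hμ.2
  linarith

/-- If γ/N ≤ 1, both terms of the radius are at most √(γ/N) and the box has width at most four
radii; otherwise the trivial bound 1 on the width suffices. -/
lemma abs_sub_le_of_mem_conf {γ x N a b : ℝ} (hγ : 0 ≤ γ) (hN : 0 < N) (hx : x ≤ 1)
    (ha : a ∈ Set.Icc (max 0 (x - 2 * rad γ x N)) (min 1 (x + 2 * rad γ x N)))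
    (hb : b ∈ Set.Icc (max 0 (x - 2 * rad γ x N)) (min 1 (x + 2 * rad γ x N))) :
    |a - b| ≤ 8 * Real.sqrt (γ / N) := by
  obtain ⟨ha1, ha2⟩ := ha
  obtain ⟨hb1, hb2⟩ := hb
  rw [max_le_iff] at ha1 hb1
  rw [le_min_iff] at ha2 hb2
  have hs := Real.sqrt_nonneg (γ / N)
  have hγN : 0 ≤ γ / N := by positivity
  rcases le_total (γ / N) 1 with h | h
  · have h1 : rad γ x N ≤ 2 * Real.sqrt (γ / N) := by
      have h2 : Real.sqrt (γ * x / N) ≤ Real.sqrt (γ / N) :=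
        Real.sqrt_le_sqrt (div_le_div_of_nonneg_right (mul_le_of_le_one_right hγ hx) hN.le)
      have h3 : γ / N ≤ Real.sqrt (γ / N) := Real.le_sqrt_of_sq_le (by nlinarith)
      unfold rad
      linarith
    rw [abs_le]
    constructor <;> linarith [ha1.2, ha2.2, hb1.2, hb2.2]
  · have h1 : 1 ≤ Real.sqrt (γ / N) := Real.one_le_sqrt.2 h
    rw [abs_le]
    constructor <;> linarith [ha1.1, ha2.1, hb1.1, hb2.1]

/-! ### Play counts and deterministic error sums. -/

section

variable {d m : ℕ} (I : ℕ → Fin m) (V : ℕ → Fin d → ℝ)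

lemma plays_succ (t : ℕ) (i : Fin m) :
    plays I (t + 1) i = plays I t i + if I t = i then 1 else 0 := by
  unfold plays
  rw [Finset.range_add_one, Finset.filter_insert]
  split_ifs with h
  · rw [Finset.card_insert_of_notMem (by simp)]
  · rfl

lemma plays_le (t : ℕ) (i : Fin m) : plays I t i ≤ t :=
  (Finset.card_filter_le _ _).trans_eq (Finset.card_range t)

lemma sum_plays (t : ℕ) : ∑ i, plays I t i = t := by
  have := Finset.card_eq_sum_card_fiberwise (f := I) (s := Finset.range t)
    (t := Finset.univ) (fun _ _ => Finset.mem_coe.2 (Finset.mem_univ _))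
  rw [Finset.card_range] at this
  exact this.symm

/-- Cauchy–Schwarz, as the play counts sum to t. -/
lemma sum_sqrt_plays_le (t : ℕ) :
    ∑ i, Real.sqrt (plays I t i) ≤ Real.sqrt (m * t) := by
  refine Real.le_sqrt_of_sq_le ?_
  have h1 := sq_sum_le_card_mul_sum_sq (s := Finset.univ)
    (f := fun i => Real.sqrt (plays I t i))
  simp only [Real.sq_sqrt (Nat.cast_nonneg _), Finset.card_univ, Fintype.card_fin] at h1
  rw [← Nat.cast_sum, sum_plays] at h1
  exact h1

lemma sum_inv_sqrt_plays_le (t : ℕ) :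
    ∑ s ∈ Finset.range t, 1 / Real.sqrt ((plays I s (I s) : ℝ) + 1)
      ≤ 2 * ∑ i, Real.sqrt (plays I t i) := by
  induction t with
  | zero => simp [plays]
  | succ t ih =>
    rw [Finset.sum_range_succ]
    have h1 : ∀ i, Real.sqrt (plays I (t + 1) i) = Real.sqrt (plays I t i)
        + if I t = i then Real.sqrt ((plays I t (I t) : ℝ) + 1) - Real.sqrt (plays I t (I t))
          else 0 := by
      intro i
      rw [plays_succ]
      split_ifs with h
      · subst h
        push_cast
        ring
      · simp
    simp_rw [h1]
    rw [Finset.sum_add_distrib]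
    simp only [Finset.sum_ite_eq, Finset.mem_univ, if_true]
    set k : ℝ := (plays I t (I t) : ℝ) with hk
    have hk0 : 0 ≤ k := Nat.cast_nonneg _
    have h2 : 0 < Real.sqrt (k + 1) := Real.sqrt_pos.2 (by linarith)
    -- The telescoping step: playing an arm raises its count from k to k + 1.
    have h3 : 1 / Real.sqrt (k + 1) ≤ 2 * (Real.sqrt (k + 1) - Real.sqrt k) := by
      rw [div_le_iff₀ h2]
      have h4 := Real.sq_sqrt hk0
      have h5 := Real.sq_sqrt (show 0 ≤ k + 1 by linarith)
      nlinarith [sq_nonneg (Real.sqrt (k + 1) - Real.sqrt k)]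
    linarith

lemma obsSum_nonneg {T : ℕ} (hV : ∀ t < T, V t ∈ unitCube d) {t : ℕ} (ht : t ≤ T) (j : Fin d)
    (i : Fin m) : 0 ≤ obsSum I V t j i :=
  Finset.sum_nonneg fun s hs => (hV s ((Finset.mem_range.1 (Finset.mem_filter.1 hs).1).trans_le
    ht)).1 j

lemma obsSum_le_plays {T : ℕ} (hV : ∀ t < T, V t ∈ unitCube d) {t : ℕ} (ht : t ≤ T) (j : Fin d)
    (i : Fin m) : obsSum I V t j i ≤ plays I t i := by
  unfold obsSum plays
  refine (Finset.sum_le_sum fun s hs => (hV s ((Finset.mem_range.1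
    (Finset.mem_filter.1 hs).1).trans_le ht)).2 j).trans ?_
  simp

lemma empMean_le_one {T : ℕ} (hV : ∀ t < T, V t ∈ unitCube d) {t : ℕ} (ht : t ≤ T) (j : Fin d)
    (i : Fin m) : empMean I V t j i ≤ 1 := by
  have h := obsSum_le_plays I V hV ht j i
  have hk : (0 : ℝ) ≤ plays I t i := Nat.cast_nonneg _
  exact (div_le_one (by linarith)).2 (h.trans (by linarith))

variable {I V}

lemma mem_confBox {T : ℕ} (hV : ∀ t < T, V t ∈ unitCube d) {t : ℕ} (ht : t ≤ T)
    {M : Matrix (Fin d) (Fin m) ℝ} (hM : ∀ j i, M j i ∈ Set.Icc (0 : ℝ) 1) {g : ℝ}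
    (hg : 1 ≤ 8 * g)
    (h : ∀ j i, |obsSum I V t j i - plays I t i * M j i|
      ≤ 2 * Real.sqrt (g * (plays I t i * M j i)) + 2 * g) :
    M ∈ confBox (16 * g) I V t := by
  intro j i
  have h1 : |empMean I V t j i - M j i|
      ≤ 2 * rad (16 * g) (empMean I V t j i) ((plays I t i : ℝ) + 1) :=
    abs_div_sub_le_rad hg (obsSum_nonneg I V hV ht j i) (Nat.cast_nonneg _) (hM j i) (h j i)
  rw [abs_le] at h1
  exact ⟨max_le (hM j i).1 (by linarith), le_min (hM j i).2 (by linarith)⟩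

lemma confBox_mem_Icc {γ : ℝ} {t : ℕ} {A : Matrix (Fin d) (Fin m) ℝ}
    (hA : A ∈ confBox γ I V t) (j : Fin d) (i : Fin m) : A j i ∈ Set.Icc (0 : ℝ) 1 :=
  ⟨(le_max_left _ _).trans (hA j i).1, (hA j i).2.trans (min_le_left _ _)⟩

lemma sum_abs_est_sub_le {T : ℕ} (hV : ∀ t < T, V t ∈ unitCube d) {γ : ℝ} (hγ : 0 ≤ γ)
    {A : ℕ → Matrix (Fin d) (Fin m) ℝ} {M : Matrix (Fin d) (Fin m) ℝ}
    (hA : ∀ t < T, A t ∈ confBox γ I V t) (hM : ∀ t < T, M ∈ confBox γ I V t) (j : Fin d) :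
    ∑ t ∈ Finset.range T, |A t j (I t) - M j (I t)| ≤ 16 * Real.sqrt (γ * (m * T)) := by
  have h1 : ∀ t ∈ Finset.range T, |A t j (I t) - M j (I t)|
      ≤ 8 * Real.sqrt γ * (1 / Real.sqrt ((plays I t (I t) : ℝ) + 1)) := by
    intro t ht
    have ht' := Finset.mem_range.1 ht
    have hN : (0 : ℝ) < (plays I t (I t) : ℝ) + 1 := by positivity
    have := abs_sub_le_of_mem_conf hγ hN (empMean_le_one I V hV ht'.le j (I t))
      (hA t ht' j (I t)) (hM t ht' j (I t))
    rw [Real.sqrt_div hγ] at this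
    exact this.trans_eq (by ring)
  refine (Finset.sum_le_sum h1).trans ?_
  rw [← Finset.mul_sum, Real.sqrt_mul hγ]
  have h2 := (sum_inv_sqrt_plays_le I T).trans
    (mul_le_mul_of_nonneg_left (sum_sqrt_plays_le I T) zero_le_two)
  have h3 := mul_le_mul_of_nonneg_left h2 (show 0 ≤ 8 * Real.sqrt γ by positivity)
  linarith

/-- Regroup the rounds by arm and apply Cauchy–Schwarz to the per-arm deviations; the additive terms
contribute g once per arm. -/
lemma abs_sum_mean_sub_le {T : ℕ} {M : Matrix (Fin d) (Fin m) ℝ}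
    (hM : ∀ j i, M j i ∈ Set.Icc (0 : ℝ) 1) {g : ℝ} (hg : 0 ≤ g) (j : Fin d)
    (h : ∀ i, |obsSum I V T j i - plays I T i * M j i|
      ≤ 2 * Real.sqrt (g * (plays I T i * M j i)) + 2 * g) :
    |∑ t ∈ Finset.range T, (M j (I t) - V t j)| ≤ 2 * Real.sqrt (g * (m * T)) + 2 * (g * m) := by
  have h1 : ∑ t ∈ Finset.range T, (M j (I t) - V t j)
      = ∑ i, -(obsSum I V T j i - plays I T i * M j i) := by
    rw [← Finset.sum_fiberwise (Finset.range T) I]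
    refine Finset.sum_congr rfl fun i _ => ?_
    have h2 : ∑ t ∈ Finset.range T with I t = i, M j (I t) = plays I T i * M j i := by
      rw [Finset.sum_congr rfl fun t ht => by rw [(Finset.mem_filter.1 ht).2], Finset.sum_const,
        nsmul_eq_mul]
      rfl
    rw [Finset.sum_sub_distrib, h2, obsSum]
    ring
  have h2 : ∀ i ∈ Finset.univ, |-(obsSum I V T j i - plays I T i * M j i)|
      ≤ 2 * Real.sqrt g * Real.sqrt (plays I T i) + 2 * g := by
    intro i _
    rw [abs_neg]
    refine (h i).trans ?_
    have h3 : Real.sqrt (g * (plays I T i * M j i)) ≤ Real.sqrt g * Real.sqrt (plays I T i) := by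
      rw [← Real.sqrt_mul hg]
      exact Real.sqrt_le_sqrt (mul_le_mul_of_nonneg_left
        (mul_le_of_le_one_right (Nat.cast_nonneg _) (hM j i).2) hg)
    linarith
  rw [h1]
  refine (Finset.abs_sum_le_sum_abs _ _).trans ((Finset.sum_le_sum h2).trans ?_)
  rw [Finset.sum_add_distrib, ← Finset.mul_sum, Real.sqrt_mul hg]
  simp only [Finset.sum_const, Finset.card_univ, Fintype.card_fin, nsmul_eq_mul]
  have h3 := mul_le_mul_of_nonneg_left (sum_sqrt_plays_le I T)
    (show 0 ≤ 2 * Real.sqrt g by positivity)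
  linarith

/-- On the good event, the averages of the estimates and of the observations are close. -/
lemma abs_avgObs_sub_le {T : ℕ} (hT : 0 < T) (hm : 0 < m) (hV : ∀ t < T, V t ∈ unitCube d)
    {M : Matrix (Fin d) (Fin m) ℝ} (hM : ∀ j i, M j i ∈ Set.Icc (0 : ℝ) 1) {g : ℝ}
    (hg : 0 < g) {A : ℕ → Matrix (Fin d) (Fin m) ℝ} {p : ℕ → Fin m → ℝ}
    (hp : ∀ t < T, p t ∈ stdSimplex ℝ (Fin m))
    (hA : ∀ t < T, A t ∈ confBox (16 * g) I V t)
    (hMc : ∀ t < T, M ∈ confBox (16 * g) I V t) (j : Fin d)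
    (hmean : ∀ i, |obsSum I V T j i - plays I T i * M j i|
      ≤ 2 * Real.sqrt (g * (plays I T i * M j i)) + 2 * g)
    (harm : |∑ t ∈ Finset.range T, (A t j (I t) - A t j ⬝ᵥ p t)|
      ≤ 2 * Real.sqrt (g * T) + 2 * g) :
    |avgObs T (fun t => A t *ᵥ p t) j - avgObs T V j|
      ≤ 18 * Real.sqrt (16 * g * m / T) := by
  have hT' : (0 : ℝ) < T := by exact_mod_cast hT
  have hm' : (1 : ℝ) ≤ m := by exact_mod_cast hm
  -- For small T the claimed bound exceeds 1, the diameter of [0,1].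
  rcases le_total (T : ℝ) (16 * g * m) with hbig | hsmall
  · have h1 : 1 ≤ Real.sqrt (16 * g * m / T) := Real.one_le_sqrt.2 ((one_le_div hT').2 hbig)
    have h2 := avgObs_mem_unitCube hT fun t ht =>
      mulVec_mem_unitCube (fun j i => confBox_mem_Icc (hA t ht) j i) (hp t ht)
    have h3 := avgObs_mem_unitCube hT hV
    have a1 := h2.1 j
    have a2 := h2.2 j
    have a3 := h3.1 j
    have a4 := h3.2 j
    simp only [Pi.zero_apply, Pi.one_apply] at a1 a2 a3 a4
    rw [abs_le]
    constructor <;> linarith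
  · have hdec : avgObs T (fun t => A t *ᵥ p t) j - avgObs T V j
        = (-(∑ t ∈ Finset.range T, (A t j (I t) - A t j ⬝ᵥ p t))
          + ∑ t ∈ Finset.range T, (A t j (I t) - M j (I t))
          + ∑ t ∈ Finset.range T, (M j (I t) - V t j)) / T := by
      simp only [avgObs, Pi.smul_apply, Finset.sum_apply, smul_eq_mul, mulVec,
        Finset.sum_sub_distrib]
      field_simp
      ring
    have h1 := (Finset.abs_sum_le_sum_abs _ _).trans
      (sum_abs_est_sub_le hV (show 0 ≤ 16 * g by positivity) hA hMc j)
    have h2 := abs_sum_mean_sub_le (V := V) hM hg.le j hmean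
    set R := Real.sqrt (16 * g * (m * T)) with hR
    have hR4 : Real.sqrt (g * (m * T)) = R / 4 := by
      rw [hR, mul_assoc, sqrt_sixteen_mul]
      ring
    have h3 : Real.sqrt (g * T) ≤ R / 4 := by
      rw [← hR4]
      exact Real.sqrt_le_sqrt (mul_le_mul_of_nonneg_left
        (le_mul_of_one_le_left hT'.le hm') hg.le)
    -- For large T the lower-order terms 2g and 2gm are at most R/8 each. The total is R/2 + 16R +
    -- R/2 + R/8 + R/8 ≤ 18R.
    have h4 : 16 * g * m ≤ R := by
      refine Real.le_sqrt_of_sq_le ?_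
      have : 0 ≤ 16 * g * m := by positivity
      nlinarith
    have h5 : g ≤ g * m := le_mul_of_one_le_right hg.le hm'
    have h6 : Real.sqrt (16 * g * m / T) = R / T := by
      rw [hR, eq_div_iff hT'.ne']
      nth_rw 2 [← Real.sqrt_sq hT'.le]
      rw [← Real.sqrt_mul (by positivity)]
      congr 1
      field_simp
    have hR0 : 0 ≤ R := Real.sqrt_nonneg _
    rw [hdec, abs_div, abs_of_pos hT', h6, mul_div_assoc']
    refine div_le_div_of_nonneg_right ?_ hT'.le
    refine (abs_add_three _ _ _).trans ?_
    rw [abs_neg]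
    linarith

end

/-! ### Union bound and the good event. -/

lemma ofReal_one_sub_le_measure_of_compl_subset {Ω : Type*} [MeasurableSpace Ω] {P : Measure Ω}
    [IsProbabilityMeasure P] {B G : Set Ω} {δ : ℝ} (hδ : 0 ≤ δ) (hB : P B ≤ ENNReal.ofReal δ)
    (hBG : Bᶜ ⊆ G) : ENNReal.ofReal (1 - δ) ≤ P G := by
  rw [ENNReal.ofReal_sub _ hδ, ENNReal.ofReal_one, tsub_le_iff_right]
  calc (1 : ℝ≥0∞) = P Set.univ := measure_univ.symm
    _ ≤ P (G ∪ B) := measure_mono fun ω _ => by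
        by_cases h : ω ∈ B
        · exact Or.inr h
        · exact Or.inl (hBG h)
    _ ≤ P G + P B := measure_union_le _ _
    _ ≤ P G + ENNReal.ofReal δ := by gcongr

/-- With Q = mTd there are at most 10Q² bad events, each of probability at most (δ/Q)^6. As Q ≥ 2
and δ < 1, δ/Q ≤ 1/2 and the remaining factor 10δ(δ/Q)^4 is below 1. -/
lemma union_bound_le {d m T : ℕ} {δ g : ℝ} (hQ : 2 ≤ m * T * d) (hδ : 0 < δ) (hδ1 : δ < 1)
    (hg : 6 * Real.log ((m : ℝ) * T * d / δ) ≤ g) :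
    (2 * ((T + 1) * ((T + 1) * (m * d))) + 2 * d : ℝ) * Real.exp (-g) ≤ δ := by
  have hT : (1 : ℝ) ≤ T := by
    have : T ≠ 0 := by rintro rfl; simp at hQ
    exact_mod_cast Nat.one_le_iff_ne_zero.2 this
  have hm : (1 : ℝ) ≤ m := by
    have : m ≠ 0 := by rintro rfl; simp at hQ
    exact_mod_cast Nat.one_le_iff_ne_zero.2 this
  have hd : (1 : ℝ) ≤ d := by
    have : d ≠ 0 := by rintro rfl; simp at hQ
    exact_mod_cast Nat.one_le_iff_ne_zero.2 this
  have hQ' : (2 : ℝ) ≤ (m : ℝ) * T * d := by exact_mod_cast hQ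
  set Q : ℝ := (m : ℝ) * T * d with hQd
  have hQ0 : 0 < Q := by linarith
  have hx : 0 < Q / δ := div_pos hQ0 hδ
  have h1 : Real.exp (-g) ≤ (δ / Q) ^ 6 := by
    have h2 : Real.exp (-g) ≤ Real.exp (-(6 * Real.log (Q / δ))) :=
      Real.exp_le_exp.2 (by linarith)
    have h3 : Real.exp (-(6 * Real.log (Q / δ))) = (δ / Q) ^ 6 := by
      rw [← mul_neg, ← Real.log_inv, inv_div]
      rw [show (6 : ℝ) * Real.log (δ / Q) = ((6 : ℕ) : ℝ) * Real.log (δ / Q) by norm_num,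
        Real.exp_nat_mul, Real.exp_log (div_pos hδ hQ0)]
    exact h2.trans_eq h3
  have hmd : (1 : ℝ) ≤ m * d := by nlinarith
  have h4 : (2 * ((T + 1) * ((T + 1) * (m * d))) + 2 * d : ℝ) ≤ 10 * Q ^ 2 := by
    have e1 : ((T : ℝ) + 1) * ((T + 1) * (m * d)) ≤ (2 * T) * ((2 * T) * (m * d)) := by
      gcongr <;> linarith
    have e2 : ((T : ℝ) * T) * (m * d) ≤ (T * T) * ((m * d) * (m * d)) := by
      refine mul_le_mul_of_nonneg_left ?_ (by positivity)
      nlinarith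
    have e3 : (d : ℝ) ≤ Q ^ 2 := by
      have e4 : (1 : ℝ) ≤ m * T := by nlinarith
      have e5 : (d : ℝ) ≤ Q := by
        rw [hQd]
        exact le_mul_of_one_le_left (by linarith) e4
      nlinarith
    have e6 : Q ^ 2 = (T * T) * ((m * d) * (m * d)) := by rw [hQd]; ring
    nlinarith
  have hr0 : 0 < δ / Q := div_pos hδ hQ0
  have hr : δ / Q ≤ 1 / 2 := by
    rw [div_le_iff₀ hQ0]
    linarith
  calc _ ≤ 10 * Q ^ 2 * (δ / Q) ^ 6 :=
        mul_le_mul h4 h1 (Real.exp_pos _).le (by positivity)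
    _ = δ * (10 * δ * (δ / Q) ^ 4) := by
        field_simp
    _ ≤ δ * 1 := by
        refine mul_le_mul_of_nonneg_left ?_ hδ.le
        have h5 : (δ / Q) ^ 4 ≤ (1 / 2) ^ 4 := pow_le_pow_left₀ hr0.le hr 4
        have h6 : 0 ≤ (δ / Q) ^ 4 := by positivity
        nlinarith
    _ = δ := mul_one δ

/-- The sign `±1` encoded by a Boolean. -/
def boolSign (b : Bool) : ℝ := if b then 1 else -1

lemma abs_boolSign_mul (b : Bool) (x : ℝ) : |boolSign b * x| = |x| := by
  cases b <;> simp [boolSign]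

lemma abs_le_of_tuning {g y x : ℝ} (hg : 0 < g)
    (h : ∀ b, boolSign b * tuning g y * x - (boolSign b * tuning g y) ^ 2 * y < g) :
    |x| ≤ 2 * Real.sqrt (g * y) + 2 * g := by
  refine abs_le'.2 ⟨le_of_tuning hg ?_, le_of_tuning hg ?_⟩
  · simpa [boolSign] using h true
  · simpa [boolSign] using h false

section

variable {d m T : ℕ} {ν : Fin m → Measure (Fin d → ℝ)} {γ : ℝ} {f : (Fin d → ℝ) → ℝ}
  {K : Set (Fin d → ℝ)} {Ξ : Type*} {oco : OCOMethod K Ξ} {Ω : Type*} [mΩ : MeasurableSpace Ω]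
  {P : Measure Ω} [IsProbabilityMeasure P] {ℱ : Filtration ℕ mΩ} {ξ : Ω → Ξ}
  {θ : ℕ → Ω → Fin d → ℝ} {p : ℕ → Ω → Fin m → ℝ} {est : ℕ → Ω → Matrix (Fin d) (Fin m) ℝ}
  {I : ℕ → Ω → Fin m} {V : ℕ → Ω → Fin d → ℝ}

/-- With high probability the mean matrix is in all confidence boxes, and the averages of the
estimates and of the observations are close. -/
lemma IsDualRun.exists_good_event (h : IsDualRun T ν γ f oco P ℱ ξ θ p est I V) {δ : ℝ}
    (hQ : 2 ≤ m * T * d) (hδ : 0 < δ) (hδ1 : δ < 1)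
    (hγ : 96 * Real.log ((m : ℝ) * T * d / δ) ≤ γ) (hν : ∀ i, IsProbabilityMeasure (ν i))
    (hcube : ∀ i, ∀ᵐ v ∂(ν i), v ∈ unitCube d) :
    ∃ G : Set Ω, ENNReal.ofReal (1 - δ) ≤ P G ∧ ∀ ω ∈ G,
      (∀ t < T, meanMatrix ν ∈ confBox γ (fun s => I s ω) (fun s => V s ω) t) ∧
      ∀ j, |avgObs T (fun t => est t ω *ᵥ p t ω) j - avgObs T (fun t => V t ω) j|
        ≤ 18 * Real.sqrt (γ * m / T) := by
  obtain ⟨g, rfl⟩ : ∃ g, γ = 16 * g := ⟨γ / 16, by ring⟩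
  have hg6 : 6 * Real.log ((m : ℝ) * T * d / δ) ≤ g := by linarith
  have hlog : (1 : ℝ) / 2 ≤ Real.log ((m : ℝ) * T * d / δ) := by
    have hQ' : (2 : ℝ) ≤ (m : ℝ) * T * d := by exact_mod_cast hQ
    have h1 : (2 : ℝ) ≤ (m : ℝ) * T * d / δ := by
      rw [le_div_iff₀ hδ]
      linarith
    have h2 := Real.log_le_log two_pos h1
    have := Real.log_two_gt_d9
    linarith
  have hg1 : 1 ≤ 8 * g := by linarith
  have hg : 0 < g := by linarith
  have hT : 0 < T := Nat.pos_of_ne_zero (by rintro rfl; simp at hQ)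
  have hm : 0 < m := Nat.pos_of_ne_zero (by rintro rfl; simp at hQ)
  have hM := meanMatrix_mem_Icc hν hcube
  have hl : ∀ b y, |boolSign b * tuning g y| ≤ 1 := fun b y => by
    rw [abs_boolSign_mul, abs_of_pos (tuning_pos hg)]
    exact tuning_le_one hg
  -- The exponent must be deterministic, yet its best value depends on the random play count. Hence
  -- the extra index n over all possible counts, specialized to the actual count afterwards; `B₂`
  -- needs none because its compensator is always T l².
  let B₁ : Bool × Fin (T + 1) × Fin (T + 1) × Fin m × Fin d → Set Ω :=
    fun ⟨b, t, n, i, j⟩ =>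
      let l := boolSign b * tuning g (n * meanMatrix ν j i)
      {ω | g ≤ l * (obsSum (fun s => I s ω) (fun s => V s ω) t j i
        - plays (fun s => I s ω) t i * meanMatrix ν j i)
        - l ^ 2 * (plays (fun s => I s ω) t i * meanMatrix ν j i)}
  let B₂ : Bool × Fin d → Set Ω := fun ⟨b, j⟩ =>
    let l := boolSign b * tuning g T
    {ω | g ≤ ∑ t ∈ Finset.range T,
      (l * (est t ω j (I t ω) - est t ω j ⬝ᵥ p t ω) - l ^ 2)}
  have hB₁ : ∀ k, P (B₁ k) ≤ ENNReal.ofReal (Real.exp (-g)) := fun ⟨b, t, n, i, j⟩ =>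
    h.interaction.measure_obsSum_le hν hcube (hl b _) j i (Nat.lt_succ_iff.1 t.2) g
  have hB₂ : ∀ k, P (B₂ k) ≤ ENNReal.ofReal (Real.exp (-g)) := fun ⟨b, j⟩ =>
    measure_sum_est_sub_le h.interaction.arm_measurable h.prob_measurable h.prob_mem h.arm_law
      (a := fun t ω i => est t ω j i) (fun t ht i => h.est_measurable t ht j i)
      (fun t ht ω i => confBox_mem_Icc (h.est_mem t ht ω) j i) (hl b _) g
  have hB : P ((⋃ k, B₁ k) ∪ ⋃ k, B₂ k) ≤ ENNReal.ofReal δ := by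
    have h1 : P (⋃ k, B₁ k) ≤ ∑ k, ENNReal.ofReal (Real.exp (-g)) :=
      (measure_iUnion_fintype_le P B₁).trans (Finset.sum_le_sum fun k _ => hB₁ k)
    have h2 : P (⋃ k, B₂ k) ≤ ∑ k, ENNReal.ofReal (Real.exp (-g)) :=
      (measure_iUnion_fintype_le P B₂).trans (Finset.sum_le_sum fun k _ => hB₂ k)
    refine (measure_union_le _ _).trans ((add_le_add h1 h2).trans ?_)
    simp only [Finset.sum_const, Finset.card_univ, Fintype.card_prod, Fintype.card_bool,
      Fintype.card_fin]
    rw [← add_nsmul, ← ENNReal.ofReal_nsmul, nsmul_eq_mul]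
    refine ENNReal.ofReal_le_ofReal ?_
    push_cast
    exact union_bound_le hQ hδ hδ1 hg6
  refine ⟨((⋃ k, B₁ k) ∪ ⋃ k, B₂ k)ᶜ,
    ofReal_one_sub_le_measure_of_compl_subset hδ.le hB subset_rfl, fun ω hω => ?_⟩
  rw [Set.compl_union, Set.mem_inter_iff, Set.mem_compl_iff, Set.mem_compl_iff, Set.mem_iUnion,
    Set.mem_iUnion, not_exists, not_exists] at hω
  obtain ⟨h1, h2⟩ := hω
  have hmean : ∀ t ≤ T, ∀ j i, |obsSum (fun s => I s ω) (fun s => V s ω) t j i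
        - plays (fun s => I s ω) t i * meanMatrix ν j i|
      ≤ 2 * Real.sqrt (g * (plays (fun s => I s ω) t i * meanMatrix ν j i)) + 2 * g := by
    intro t ht j i
    have hn : plays (fun s => I s ω) t i < T + 1 :=
      Nat.lt_succ_iff.2 ((plays_le (fun s => I s ω) t i).trans ht)
    exact abs_le_of_tuning hg fun b =>
      not_le.1 (h1 ⟨b, ⟨t, Nat.lt_succ_iff.2 ht⟩, ⟨_, hn⟩, i, j⟩)
  have harm : ∀ j, |∑ t ∈ Finset.range T, (est t ω j (I t ω) - est t ω j ⬝ᵥ p t ω)|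
      ≤ 2 * Real.sqrt (g * T) + 2 * g := by
    intro j
    refine abs_le_of_tuning hg fun b => ?_
    have h3 : ∑ t ∈ Finset.range T, (boolSign b * tuning g T *
        (est t ω j (I t ω) - est t ω j ⬝ᵥ p t ω) - (boolSign b * tuning g T) ^ 2) < g :=
      not_le.1 fun hle => h2 ⟨b, j⟩ hle
    rw [Finset.sum_sub_distrib, ← Finset.mul_sum, Finset.sum_const, Finset.card_range,
      nsmul_eq_mul] at h3
    linarith
  have hV : ∀ t < T, V t ω ∈ unitCube d := fun t ht => h.interaction.obs_mem t ht ω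
  have hbox : ∀ t < T, meanMatrix ν ∈ confBox (16 * g) (fun s => I s ω) (fun s => V s ω) t :=
    fun t ht => mem_confBox hV ht.le hM hg1 (hmean t ht.le)
  exact ⟨hbox, fun j => abs_avgObs_sub_le hT hm hV hM hg (fun t ht => h.prob_mem t ht ω)
    (fun t ht => h.est_mem t ht ω) hbox j (hmean T le_rfl j) (harm j)⟩

end

/-! ### Regret on the good event and the two conclusions. -/

section

variable {q : ENNReal} [Fact (1 ≤ q)] {d m T : ℕ} {ν : Fin m → Measure (Fin d → ℝ)} {γ L : ℝ}
  {f : (Fin d → ℝ) → ℝ} {Ξ : Type*} {oco : OCOMethod (dualBall q d L) Ξ} {Ω : Type*}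
  [mΩ : MeasurableSpace Ω] {P : Measure Ω} {ℱ : Filtration ℕ mΩ} {ξ : Ω → Ξ}
  {θ : ℕ → Ω → Fin d → ℝ} {p : ℕ → Ω → Fin m → ℝ} {est : ℕ → Ω → Matrix (Fin d) (Fin m) ℝ}
  {I : ℕ → Ω → Fin m} {V : ℕ → Ω → Fin d → ℝ}

/-- The regret of the dual run against any fixed mixture of the arms, on the good event. -/
lemma IsDualRun.sub_le (h : IsDualRun T ν γ f oco P ℱ ξ θ p est I V) (hT : 0 < T) (hL : 0 ≤ L)
    (hf : ConcaveOn ℝ (unitCube d) f)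
    (hlip : ∀ x ∈ unitCube d, ∀ y ∈ unitCube d, f x - f y ≤ L * lqNorm q (x - y))
    (hM : ∀ j i, meanMatrix ν j i ∈ Set.Icc (0 : ℝ) 1) {ω : Ω}
    (hbox : ∀ t < T, meanMatrix ν ∈ confBox γ (fun s => I s ω) (fun s => V s ω) t) {c : ℝ}
    (hc : 0 ≤ c)
    (hclose : ∀ j, |avgObs T (fun t => est t ω *ᵥ p t ω) j - avgObs T (fun t => V t ω) j| ≤ c)
    {p' : Fin m → ℝ} (hp' : p' ∈ stdSimplex ℝ (Fin m)) :
    f (meanMatrix ν *ᵥ p') - f (avgObs T fun t => V t ω) ≤ L * (c * lqNorm q (1 : Fin d → ℝ)) +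
      ocoRegret (dualBall q d L) T (fun t => dualLoss f (est t ω *ᵥ p t ω))
        (fun t => θ t ω) / T := by
  have hx : avgObs T (fun t => est t ω *ᵥ p t ω) ∈ unitCube d :=
    avgObs_mem_unitCube hT fun t ht => mulVec_mem_unitCube
      (fun j i => confBox_mem_Icc (h.est_mem t ht ω) j i) (h.prob_mem t ht ω)
  have hv : avgObs T (fun t => V t ω) ∈ unitCube d :=
    avgObs_mem_unitCube hT fun t ht => h.interaction.obs_mem t ht ω
  have h1 := sub_le_ocoRegret_div q hT hL hf hlip (θ := fun t => θ t ω) hx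
    (mulVec_mem_unitCube hM hp') fun t ht => h.minimal t ht ω p' hp' _ (hbox t ht)
  have h2 := hlip _ hx _ hv
  have h3 := mul_le_mul_of_nonneg_left
    (lqNorm_le_of_abs_le q (x := avgObs T (fun t => est t ω *ᵥ p t ω) - avgObs T fun t => V t ω)
      hc hclose) hL
  linarith

end

end BwCR

end

theorem theorem3 :
    ∃ c₀ : ℝ, 0 < c₀ ∧ ∃ C : ℝ, 0 < C ∧
      ∀ (q : ENNReal) [Fact (1 ≤ q)] (d m T : ℕ) (δ γ : ℝ),
        2 ≤ m * T * d → 0 < δ → δ < 1 →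
        c₀ * Real.log ((m : ℝ) * T * d / δ) ≤ γ →
      ∀ (ν : Fin m → Measure (Fin d → ℝ)),
        (∀ i, IsProbabilityMeasure (ν i)) →
        (∀ i, ∀ᵐ v ∂(ν i), v ∈ BwCR.unitCube d) →
      ∀ (Ω : Type*) (mΩ : MeasurableSpace Ω) (P : Measure Ω) [IsProbabilityMeasure P]
        (ℱ : Filtration ℕ mΩ) (Ξ : Type*) (ξ : Ω → Ξ)
        (θ : ℕ → Ω → Fin d → ℝ) (p : ℕ → Ω → Fin m → ℝ)
        (est : ℕ → Ω → Matrix (Fin d) (Fin m) ℝ)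
        (I : ℕ → Ω → Fin m) (V : ℕ → Ω → Fin d → ℝ),
        -- concave rewards
        (∀ (f : (Fin d → ℝ) → ℝ) (L : ℝ),
          ConcaveOn ℝ (BwCR.unitCube d) f →
          (∀ x ∈ BwCR.unitCube d, f x ∈ Set.Icc (0 : ℝ) 1) →
          (∀ x ∈ BwCR.unitCube d, ∀ y ∈ BwCR.unitCube d,
            f x - f y ≤ L * BwCR.lqNorm q (x - y)) →
          ∀ oco : BwCR.OCOMethod (BwCR.dualBall q d L) Ξ,
            BwCR.IsDualRun T ν γ f oco P ℱ ξ θ p est I V →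
            ENNReal.ofReal (1 - δ) ≤ P {ω |
              BwCR.optValue T ν f - f (BwCR.avgObs T fun t => V t ω) ≤
                C * (L * BwCR.lqNorm q (1 : Fin d → ℝ) * Real.sqrt (γ * m / T)) +
                  BwCR.ocoRegret (BwCR.dualBall q d L) T
                    (fun t => BwCR.dualLoss f (est t ω *ᵥ p t ω)) (fun t => θ t ω) / T}) ∧
        -- convex knapsacks
        (∀ S : Set (Fin d → ℝ),
          Convex ℝ S →
          (∃ p' ∈ stdSimplex ℝ (Fin m), BwCR.meanMatrix ν *ᵥ p' ∈ S) →
          ∀ oco : BwCR.OCOMethod (BwCR.dualBall q d 1) Ξ,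
            BwCR.IsDualRun T ν γ (fun x => -BwCR.lqDist q x S) oco P ℱ ξ θ p est I V →
            ENNReal.ofReal (1 - δ) ≤ P {ω |
              BwCR.lqDist q (BwCR.avgObs T fun t => V t ω) S ≤
                C * (BwCR.lqNorm q (1 : Fin d → ℝ) * Real.sqrt (γ * m / T)) +
                  BwCR.ocoRegret (BwCR.dualBall q d 1) T
                    (fun t => BwCR.dualLoss (fun x => -BwCR.lqDist q x S) (est t ω *ᵥ p t ω))
                    (fun t => θ t ω) / T}) := by
  -- 96 = 16·6: γ = 16g from the radius comparison and g ≥ 6 ln(mTd/δ) from the union bound.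
  refine ⟨96, by norm_num, 18, by norm_num, ?_⟩
  intro q hq d m T δ γ hQ hδ hδ1 hγ ν hν hcube Ω mΩ P hP ℱ Ξ ξ θ p est I V
  have hT : 0 < T := Nat.pos_of_ne_zero (by rintro rfl; simp at hQ)
  have hd : 0 < d := Nat.pos_of_ne_zero (by rintro rfl; simp at hQ)
  have hM := BwCR.meanMatrix_mem_Icc hν hcube
  constructor
  · intro f L hf hf01 hlip oco h
    have h0 : (0 : Fin d → ℝ) ∈ BwCR.unitCube d := ⟨le_rfl, zero_le_one⟩
    have h1 : (1 : Fin d → ℝ) ∈ BwCR.unitCube d := ⟨zero_le_one, le_rfl⟩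
    -- Adding the Lipschitz inequalities for (0, 1) and (1, 0) gives 0 ≤ 2L‖1‖, and ‖1‖ > 0 because
    -- d > 0.
    have hL : 0 ≤ L := by
      have e1 := hlip _ h0 _ h1
      have e2 := hlip _ h1 _ h0
      have e3 : BwCR.lqNorm q (0 - 1 : Fin d → ℝ) = BwCR.lqNorm q (1 : Fin d → ℝ) := by
        rw [zero_sub]
        exact norm_neg _
      have e4 : 0 < BwCR.lqNorm q (1 : Fin d → ℝ) := by
        refine norm_pos_iff.2 fun e => ?_
        have := congrFun (congrArg WithLp.ofLp e) ⟨0, hd⟩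
        simp at this
      rw [sub_zero] at e2
      rw [e3] at e1
      by_contra hneg
      have := mul_neg_of_neg_of_pos (not_le.1 hneg) e4
      linarith
    obtain ⟨G, hG, hgood⟩ := h.exists_good_event hQ hδ hδ1 hγ hν hcube
    refine hG.trans (measure_mono fun ω hω => ?_)
    obtain ⟨hbox, hclose⟩ := hgood ω hω
    have key := fun p' hp' => h.sub_le (p' := p') hT hL hf hlip hM hbox (by positivity) hclose hp'
    have hv := hf01 _ (BwCR.avgObs_mem_unitCube hT fun t ht => h.interaction.obs_mem t ht ω)
    have hm : 0 < m := Nat.pos_of_ne_zero (by rintro rfl; simp at hQ)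
    -- Any mixture, here a single arm, shows that the final bound is nonnegative, as f(μp₀) ≥ 0.
    have hp₀ := single_mem_stdSimplex ℝ (⟨0, hm⟩ : Fin m)
    have hle := BwCR.optValue_le hT hf (BwCR.continuousOn_of_lqNorm_lipschitz q hL hlip)
      (fun x hx => (hf01 x hx).1) hM
      (((hf01 _ (BwCR.mulVec_mem_unitCube hM hp₀)).1).trans (sub_le_iff_le_add.1 (key _ hp₀)))
      (fun p' hp' => sub_le_iff_le_add.1 (key p' hp'))
    rw [Set.mem_ofPred_eq, sub_le_iff_le_add]
    refine hle.trans_eq ?_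
    ring
  · rintro S hS ⟨p', hp', hp'S⟩ oco h
    have hf : ConcaveOn ℝ (BwCR.unitCube d) (fun x => -BwCR.lqDist q x S) :=
      BwCR.concaveOn_neg_lqDist q hS ⟨_, hp'S⟩ _ (convex_Icc _ _)
    have hlip : ∀ x ∈ BwCR.unitCube d, ∀ y ∈ BwCR.unitCube d,
        -BwCR.lqDist q x S - -BwCR.lqDist q y S ≤ 1 * BwCR.lqNorm q (x - y) := by
      intro x _ y _
      have e1 := BwCR.lqDist_sub_le q S y x
      have e2 : BwCR.lqNorm q (y - x) = BwCR.lqNorm q (x - y) := by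
        rw [← neg_sub x y]
        exact norm_neg _
      linarith
    obtain ⟨G, hG, hgood⟩ := h.exists_good_event hQ hδ hδ1 hγ hν hcube
    refine hG.trans (measure_mono fun ω hω => ?_)
    obtain ⟨hbox, hclose⟩ := hgood ω hω
    have key := h.sub_le hT zero_le_one hf hlip hM hbox (by positivity) hclose hp'
    have hzero : BwCR.lqDist q (BwCR.meanMatrix ν *ᵥ p') S = 0 :=
      Metric.infDist_zero_of_mem (Set.mem_image_of_mem _ hp'S)
    rw [hzero] at key
    rw [Set.mem_ofPred_eq]
    linarith
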